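/- Let $1<\alpha<2$, let $d\in\mathbb N$ with $d>\alpha$, and let $|\cdot|$ be the Euclidean norm. Let $\{w_{x,y}\}$, indexed by the unordered pairs of distinct points $x\neq y$ of $\mathbb Z^d$ (so $w_{x,y}=w_{y,x}$), be i.i.d. non-negative random variables on a probability space $(\Omega,\mathcal F,\mathbb P)$ with $\mathbb E[w_{x,y}]=1$ and $w_{x,y}\le C_1$ for some constant $C_1>0$. For $m\in\mathbb N$ put $B_{2^m}=(-2^m,2^m]^d\cap\mathbb Z^d$, and for $f:B_{2^m}\to\mathbb R^d$ put $$\mathcal L_{B_{2^m}}f(x)=\sum_{y\in B_{2^m},\,y\ne x}(f(y)-f(x))\frac{w_{x,y}}{|x-y|^{d+\alpha}},\qquad \mathscr E_{B_{2^m}}(f,f)=\frac12\sum_{i=1}^d\sum_{x,y\in B_{2^m},\,x\neq y}\bigl(f^{(i)}(x)-f^{(i)}(y)\bigr)^2\frac{w_{x,y}}{|x-y|^{d+\alpha}}.$$ Let $V(x)=\sum_{z\in\mathbb Z^d\setminus\{0\}}\frac{z}{|z|^{d+\alpha}}\,w_{x,x+z}$ for $x\in\mathbb Z^d$. Then for every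 $\gamma>0$ there exist a (deterministic) constant $C_3>0$ and a random variable $m_1^*\ge 1$ such that, almost surely, for every integer $m>m_1^*(\omega)$ the local Poisson equation $$\mathcal L_{B_{2^m}}\phi_m(x)=-V(x)+\frac{1}{|B_{2^m}|}\sum_{y\in B_{2^m}}V(y)\quad (x\in B_{2^m}),\qquad \sum_{x\in B_{2^m}}\phi_m(x)=0,$$ has a unique solution $\phi_m:B_{2^m}\to\mathbb R^d$, and $$\mathscr E_{B_{2^m}}(\phi_m,\phi_m)\le C_3\,m^{\frac{(1+\gamma)\alpha}{(2(d-\alpha))\wedge d}}\,2^{md}.$$ -/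

import Mathlib

open MeasureTheory ProbabilityTheory

noncomputable section

namespace StableConductance

/-- The integer lattice `ℤ^d`. -/
abbrev Lattice (d : ℕ) : Type := Fin d → ℤ

/-- The inclusion of `ℤ^d` into Euclidean space `ℝ^d`. -/
def toEuclidean {d : ℕ} (z : Lattice d) : EuclideanSpace ℝ (Fin d) :=
  WithLp.toLp 2 (fun i => (z i : ℝ))

/-- The cube `(-R, R]^d ∩ ℤ^d`. -/
def box (d : ℕ) (R : ℤ) : Finset (Lattice d) :=
  Fintype.piFinset (fun _ => Finset.Ioc (-R) R)

/-- The jump kernel `w_{x,y} / |x - y|^{d+α}` for the conductances `w`, which are attached to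
unordered pairs (the values of `w` on the diagonal are irrelevant below). -/
def kernel {d : ℕ} (α : ℝ) (w : Sym2 (Lattice d) → ℝ) (x y : Lattice d) : ℝ :=
  w s(x, y) / ‖toEuclidean (x - y)‖ ^ ((d : ℝ) + α)

/-- The mean of a vector-valued function over a finite set `U`. -/
def mean {d : ℕ} (U : Finset (Lattice d)) (f : Lattice d → EuclideanSpace ℝ (Fin d)) :
    EuclideanSpace ℝ (Fin d) :=
  (U.card : ℝ)⁻¹ • ∑ x ∈ U, f x

/-- The operator `L_U f (x) = ∑_{y ∈ U, y ≠ x} (f y - f x) w_{x,y} / |x - y|^{d+α}` on functions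
on the finite set `U`. -/
def localGenerator {d : ℕ} (α : ℝ) (w : Sym2 (Lattice d) → ℝ) (U : Finset (Lattice d))
    (f : U → EuclideanSpace ℝ (Fin d)) (x : U) : EuclideanSpace ℝ (Fin d) :=
  ∑ y ∈ Finset.univ.erase x, kernel α w x y • (f y - f x)

/-- The energy `E_U(f, f) = 1/2 ∑_i ∑_{x ≠ y in U} (f_i x - f_i y)^2 w_{x,y} / |x - y|^{d+α}`. -/
def localEnergy {d : ℕ} (α : ℝ) (w : Sym2 (Lattice d) → ℝ) (U : Finset (Lattice d))
    (f : U → EuclideanSpace ℝ (Fin d)) : ℝ :=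
  1 / 2 * ∑ i : Fin d, ∑ x : U, ∑ y ∈ Finset.univ.erase x,
    (f x i - f y i) ^ 2 * kernel α w x y

/-- The drift `V(x) = ∑_{z ∈ ℤ^d} (z / |z|^{d+α}) w_{x,x+z}`; the term `z = 0` is zero.
For bounded `w` and `α > 1` the series converges absolutely. -/
def drift {d : ℕ} (α : ℝ) (w : Sym2 (Lattice d) → ℝ) (x : Lattice d) :
    EuclideanSpace ℝ (Fin d) :=
  ∑' z : Lattice d, (w s(x, x + z) / ‖toEuclidean z‖ ^ ((d : ℝ) + α)) • toEuclidean z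

/-- `φ` solves the local Poisson equation on `U`:
`L_U φ = -V + mean_U V` on `U` and `∑_{x ∈ U} φ x = 0`. -/
def IsLocalCorrector {d : ℕ} (α : ℝ) (w : Sym2 (Lattice d) → ℝ) (U : Finset (Lattice d))
    (φ : U → EuclideanSpace ℝ (Fin d)) : Prop :=
  (∀ x : U, localGenerator α w U φ x = -drift α w x + mean U (drift α w)) ∧ ∑ x : U, φ x = 0

/-- The unordered pairs of distinct lattice points. -/
abbrev Edge (d : ℕ) : Type := {e : Sym2 (Lattice d) // ¬ e.IsDiag}

/-- The standing assumption on the random conductances: over the unordered pairs of distinct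
points they are i.i.d., non-negative, of mean one, and bounded by a constant. -/
structure IIDConductances {d : ℕ} {Ω : Type*} [MeasurableSpace Ω] (P : Measure Ω)
    (w : Sym2 (Lattice d) → Ω → ℝ) : Prop where
  measurable : ∀ e : Edge d, Measurable (w e)
  indep : iIndepFun (fun e : Edge d => w e) P
  ident : ∀ e e' : Edge d, IdentDistrib (w e) (w e') P P
  nonneg : ∀ e : Edge d, ∀ᵐ ω ∂P, 0 ≤ w e ω
  mean_one : ∀ e : Edge d, ∫ ω, w e ω ∂P = 1
  bounded : ∃ C : ℝ, 0 < C ∧ ∀ e : Edge d, ∀ᵐ ω ∂P, w e ω ≤ C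

end StableConductance

end

/-!
Let `B` be the box of side `2^{m+1}`, cut into dyadic cells of side `2^n` for every `n ≤ m + 1`.
As `z / |z|^{d+α}` is odd, the edges inside a cell `Q` do not contribute to `∑_{x ∈ Q} V(x)`, which
is thus a sum of independent centred variables over the edges leaving `Q`; Hoeffding's inequality
bounds it by a constant times `√(m |Q|)` outside an event of probability `e^{-cm}`. It also shows
that any two points of a cell with `|Q| ≳ m` are joined inside the cell by many two-step paths of
large weight; as the kernel is at least of order `2^{-n(d+α)} w` inside a cell, this yields a
Poincaré inequality with constant of order `2^{nα}`. By Borel–Cantelli all this holds, for large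
`m`, at every scale `n` between `n₀` and `m + 1`, where `2^{n₀ d} ≍ m`.

At the top scale the Poincaré inequality makes the generator invertible modulo constants. The energy
of the solution is `∑ V φ`; telescoping `φ` over its averages on cells, with the boundedness of `V`
at the scale `n₀` and the concentrated averages of `V` above it, and applying Cauchy–Schwarz at each
scale, bounds the energy by `|B| (2^{n₀ α/2} + ∑_{n ≥ n₀} √m 2^{-nd/2} 2^{nα/2})²`. As `α < d` the
sum is geometric and dominated by its first term, so the energy is of order
`2^{n₀ α} |B| ≍ m^{α/d} 2^{md}`, and `α / d` is smaller than the exponent sought.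
-/

namespace StableConductance

section BlockAverages

variable {X K : Type*} [Fintype X] [DecidableEq K]

/-- The average of `f` over the block of `x`, the blocks being the fibres of the label `c`. -/
noncomputable def blockAvg (c : X → K) (f : X → ℝ) (x : X) : ℝ :=
  (∑ y with c y = c x, f y) / (Finset.card {y | c y = c x} : ℝ)

variable {c c' : X → K}

lemma blockAvg_sub (f g : X → ℝ) (x : X) :
    blockAvg c (fun y => f y - g y) x = blockAvg c f x - blockAvg c g x := by
  simp only [blockAvg, Finset.sum_sub_distrib, sub_div]

lemma card_block_pos (c : X → K) (x : X) : (0 : ℝ) < Finset.card {y | c y = c x} := by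
  exact_mod_cast Finset.card_pos.mpr ⟨x, by simp⟩

lemma blockAvg_eq_self {f : X → ℝ} {x : X} (hf : ∀ y, c y = c x → f y = f x) :
    blockAvg c f x = f x := by
  have hsum : ∑ y with c y = c x, f y = ∑ y with c y = c x, f x :=
    Finset.sum_congr rfl fun y hy => hf y (Finset.mem_filter.mp hy).2
  rw [blockAvg, hsum, Finset.sum_const, nsmul_eq_mul,
    mul_div_cancel_left₀ _ (card_block_pos c x).ne']

lemma blockAvg_blockAvg_of_refines (hcc' : ∀ x y, c x = c y → c' x = c' y) (f : X → ℝ) (x : X) :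
    blockAvg c (blockAvg c' f) x = blockAvg c' f x :=
  blockAvg_eq_self fun y hy => by simp only [blockAvg, hcc' y x hy]

lemma blockAvg_eq_zero {f : X → ℝ} (hc : ∀ x y, c x = c y) (hf : ∑ x, f x = 0) (x : X) :
    blockAvg c f x = 0 := by
  simp only [blockAvg, hc _ x, Finset.filter_true, hf, zero_div]

lemma sum_mul_blockAvg (c : X → K) (f g : X → ℝ) :
    ∑ x, f x * blockAvg c g x = ∑ x, blockAvg c f x * g x := by
  simp only [blockAvg, Finset.sum_filter, Finset.sum_div, Finset.mul_sum, Finset.sum_mul]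
  rw [Finset.sum_comm]
  refine Finset.sum_congr rfl fun y _ => Finset.sum_congr rfl fun x _ => ?_
  by_cases h : c x = c y
  · simp only [h, if_true]
    ring
  · simp only [h, Ne.symm h, if_false, zero_div, mul_zero, zero_mul]

lemma sq_sub_blockAvg_le (c : X → K) (f : X → ℝ) (x : X) :
    (f x - blockAvg c f x) ^ 2 ≤
      (∑ y with c y = c x, (f x - f y) ^ 2) / (Finset.card {y | c y = c x} : ℝ) := by
  have hcard := (card_block_pos c x).ne'
  have hsub : f x - blockAvg c f x =
      (∑ y with c y = c x, (f x - f y)) / (Finset.card {y | c y = c x} : ℝ) := by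
    rw [Finset.sum_sub_distrib, Finset.sum_const, nsmul_eq_mul, sub_div,
      mul_div_cancel_left₀ _ hcard, blockAvg]
  rw [hsub]
  exact sum_div_card_sq_le_sum_sq_div_card

/-- As `blockAvg c` is a self-adjoint projection whose range contains that of `blockAvg c'`, it may
be moved onto `V`. -/
lemma sum_mul_blockAvg_sub_blockAvg (hcc' : ∀ x y, c x = c y → c' x = c' y) (V f : X → ℝ) :
    ∑ x, V x * (blockAvg c f x - blockAvg c' f x) =
      ∑ x, blockAvg c V x * (f x - blockAvg c' f x) := by
  rw [← sum_mul_blockAvg]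
  simp only [blockAvg_sub, blockAvg_blockAvg_of_refines hcc']

end BlockAverages

section MultiscaleDuality

variable {X K : Type*} [Fintype X] [DecidableEq K]

lemma sum_mul_le_of_abs_le {V g : X → ℝ} {v S : ℝ} (hV : ∀ x, |V x| ≤ v)
    (hg : ∑ x, g x ^ 2 ≤ S) : ∑ x, V x * g x ≤ √(Fintype.card X) * (v * √S) := by
  rcases isEmpty_or_nonempty X with hX | ⟨⟨x⟩⟩
  · simp
  have hv : 0 ≤ v := (abs_nonneg _).trans (hV x)
  have hV2 : ∑ x, V x ^ 2 ≤ Fintype.card X * v ^ 2 := by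
    simpa using Finset.sum_le_sum fun x (_ : x ∈ Finset.univ) => sq_le_sq' (abs_le.mp (hV x)).1
      (abs_le.mp (hV x)).2
  calc ∑ x, V x * g x ≤ √(∑ x, V x ^ 2) * √(∑ x, g x ^ 2) :=
        Real.sum_mul_le_sqrt_mul_sqrt Finset.univ V g
    _ ≤ √(Fintype.card X * v ^ 2) * √S := by gcongr
    _ = √(Fintype.card X) * (v * √S) := by
        rw [Real.sqrt_mul (Nat.cast_nonneg _), Real.sqrt_sq hv, mul_assoc]

lemma le_sq_of_le_mul_sqrt {E a : ℝ} (hE : 0 ≤ E) (h : E ≤ a * √E) : E ≤ a ^ 2 := by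
  rcases hE.eq_or_lt with rfl | hpos
  · exact sq_nonneg a
  have ha : √E ≤ a := le_of_mul_le_mul_right (by rwa [Real.mul_self_sqrt hE])
    (Real.sqrt_pos.mpr hpos)
  calc E = √E ^ 2 := (Real.sq_sqrt hE).symm
    _ ≤ a ^ 2 := by gcongr

variable {c : ℕ → X → K} {V φ : X → ℝ} {n₀ M : ℕ}

lemma sum_mul_eq_sum_scales (hn : n₀ ≤ M) (hc : ∀ n x y, c n x = c n y → c (n + 1) x = c (n + 1) y)
    (htop : ∀ x y, c M x = c M y) (hφ : ∑ x, φ x = 0) :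
    ∑ x, V x * φ x = ∑ x, V x * (φ x - blockAvg (c n₀) φ x) +
      ∑ n ∈ Finset.Ico n₀ M, ∑ x, blockAvg (c n) V x * (φ x - blockAvg (c (n + 1)) φ x) := by
  have htelescope (x : X) : φ x = φ x - blockAvg (c n₀) φ x +
      ∑ n ∈ Finset.Ico n₀ M, (blockAvg (c n) φ x - blockAvg (c (n + 1)) φ x) := by
    have hsum := Finset.sum_Ico_sub (fun n => blockAvg (c n) φ x) hn
    rw [blockAvg_eq_zero htop hφ] at hsum
    simp only [← neg_sub (blockAvg (c (_ + 1)) φ x), Finset.sum_neg_distrib, hsum]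
    ring
  calc ∑ x, V x * φ x
      = ∑ x, V x * (φ x - blockAvg (c n₀) φ x) +
        ∑ n ∈ Finset.Ico n₀ M, ∑ x, V x * (blockAvg (c n) φ x - blockAvg (c (n + 1)) φ x) := by
        rw [Finset.sum_comm, ← Finset.sum_add_distrib]
        refine Finset.sum_congr rfl fun x _ => ?_
        rw [← Finset.mul_sum, ← mul_add, ← htelescope x]
    _ = _ := by simp only [sum_mul_blockAvg_sub_blockAvg (hc _)]

/-- Multiscale duality: below the scale `n₀` only the size of `V` is used, and between the scales
`n` and `n + 1` only its averages over the blocks of scale `n`. -/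
theorem energy_le_of_multiscale (hn : n₀ ≤ M)
    (hc : ∀ n x y, c n x = c n y → c (n + 1) x = c (n + 1) y) (htop : ∀ x y, c M x = c M y)
    (hφ : ∑ x, φ x = 0) {E C₀ : ℝ} {D v : ℕ → ℝ} (hE : 0 ≤ E) (hEV : E ≤ ∑ x, V x * φ x)
    (hpoincare : ∀ n, n₀ ≤ n → n ≤ M → ∑ x, (φ x - blockAvg (c n) φ x) ^ 2 ≤ D n * E)
    (hV : ∀ x, |V x| ≤ C₀) (havg : ∀ n, n₀ ≤ n → n < M → ∀ x, |blockAvg (c n) V x| ≤ v n) :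
    E ≤ Fintype.card X * (C₀ * √(D n₀) + ∑ n ∈ Finset.Ico n₀ M, v n * √(D (n + 1))) ^ 2 := by
  have hfine : ∑ x, V x * (φ x - blockAvg (c n₀) φ x) ≤
      √(Fintype.card X) * (C₀ * √(D n₀ * E)) :=
    sum_mul_le_of_abs_le hV (hpoincare n₀ le_rfl hn)
  have hscale : ∀ n ∈ Finset.Ico n₀ M,
      ∑ x, blockAvg (c n) V x * (φ x - blockAvg (c (n + 1)) φ x) ≤
        √(Fintype.card X) * (v n * √(D (n + 1) * E)) := fun n hnM => by
    obtain ⟨hn₀, hnM⟩ := Finset.mem_Ico.mp hnM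
    exact sum_mul_le_of_abs_le (havg n hn₀ hnM) (hpoincare (n + 1) (by lia) hnM)
  have hbound : E ≤ √(Fintype.card X) *
      (C₀ * √(D n₀) + ∑ n ∈ Finset.Ico n₀ M, v n * √(D (n + 1))) * √E := calc
    E ≤ ∑ x, V x * φ x := hEV
    _ ≤ √(Fintype.card X) * (C₀ * √(D n₀ * E)) +
        ∑ n ∈ Finset.Ico n₀ M, √(Fintype.card X) * (v n * √(D (n + 1) * E)) := by
      rw [sum_mul_eq_sum_scales hn hc htop hφ]
      exact add_le_add hfine (Finset.sum_le_sum hscale)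
    _ = _ := by
      simp only [Real.sqrt_mul' _ hE, ← Finset.mul_sum, ← mul_assoc (v _), ← Finset.sum_mul]
      ring
  calc E ≤ _ := le_sq_of_le_mul_sqrt hE hbound
    _ = _ := by rw [mul_pow, Real.sq_sqrt (Nat.cast_nonneg _)]

end MultiscaleDuality

section Network

variable {X : Type*} [Fintype X] {k : X → X → ℝ}

/-- The Dirichlet form of the network on `X` with conductances `k`. -/
noncomputable def dirichlet (k : X → X → ℝ) (f : X → ℝ) : ℝ :=
  1 / 2 * ∑ x, ∑ y, (f x - f y) ^ 2 * k x y

/-- The generator of the random walk on the network on `X` with conductances `k`. -/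
noncomputable def generator (k : X → X → ℝ) : (X → ℝ) →ₗ[ℝ] X → ℝ :=
  LinearMap.pi fun x => ∑ y, k x y •
    (LinearMap.proj (R := ℝ) (φ := fun _ : X => ℝ) y - LinearMap.proj x)

lemma generator_apply (k : X → X → ℝ) (f : X → ℝ) (x : X) :
    generator k f x = ∑ y, k x y * (f y - f x) := by
  simp [generator, LinearMap.sum_apply]

lemma dirichlet_nonneg (hk : ∀ x y, 0 ≤ k x y) (f : X → ℝ) : 0 ≤ dirichlet k f :=
  mul_nonneg (by norm_num) <| Finset.sum_nonneg fun x _ => Finset.sum_nonneg fun y _ =>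
    mul_nonneg (sq_nonneg _) (hk x y)

lemma dirichlet_eq_neg_sum (hk : ∀ x y, k x y = k y x) (f : X → ℝ) :
    dirichlet k f = -∑ x, generator k f x * f x := by
  have hexpand : ∑ x, generator k f x * f x = ∑ x, ∑ y, k x y * (f y - f x) * f x := by
    simp only [generator_apply, Finset.sum_mul]
  have hswap : ∑ x, generator k f x * f x = ∑ x, ∑ y, k x y * (f x - f y) * f y := by
    rw [hexpand, Finset.sum_comm]
    simp only [hk]
  have hsum : 2 * ∑ x, generator k f x * f x = -∑ x, ∑ y, (f x - f y) ^ 2 * k x y := by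
    rw [two_mul]
    nth_rewrite 1 [hexpand]
    rw [hswap]
    simp only [← Finset.sum_add_distrib, ← Finset.sum_neg_distrib]
    exact Finset.sum_congr rfl fun x _ => Finset.sum_congr rfl fun y _ => by ring
  rw [dirichlet]
  linarith

lemma sum_generator_eq_zero (hk : ∀ x y, k x y = k y x) (f : X → ℝ) :
    ∑ x, generator k f x = 0 := by
  have h : ∑ x, generator k f x = -∑ x, generator k f x := by
    simp only [generator_apply, ← Finset.sum_neg_distrib]
    rw [Finset.sum_comm]
    refine Finset.sum_congr rfl fun x _ => Finset.sum_congr rfl fun y _ => ?_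
    rw [hk y x]
    ring
  linarith

lemma eq_zero_of_generator_eq_zero (hk : ∀ x y, k x y = k y x)
    (hirr : ∀ f : X → ℝ, dirichlet k f = 0 → ∀ x y, f x = f y) {f : X → ℝ}
    (hf : generator k f = 0) (hsum : ∑ x, f x = 0) : f = 0 := by
  have hconst : ∀ x y, f x = f y := hirr f <| by simp [dirichlet_eq_neg_sum hk, hf]
  funext x
  have : Nonempty X := ⟨x⟩
  simpa [hconst _ x] using hsum

theorem existsUnique_generator_eq (hk : ∀ x y, k x y = k y x)
    (hirr : ∀ f : X → ℝ, dirichlet k f = 0 → ∀ x y, f x = f y) {g : X → ℝ} (hg : ∑ x, g x = 0) :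
    ∃! f : X → ℝ, generator k f = g ∧ ∑ x, f x = 0 := by
  -- The sum of `f` is added to every equation: the system is then square and nonsingular.
  let T : (X → ℝ) →ₗ[ℝ] X → ℝ := generator k + LinearMap.pi fun _ => ∑ y, LinearMap.proj y
  have hT_apply (f : X → ℝ) (x : X) : T f x = generator k f x + ∑ y, f y := by
    simp [T, LinearMap.sum_apply]
  have hT {f g : X → ℝ} (hg : ∑ x, g x = 0) : T f = g ↔ generator k f = g ∧ ∑ x, f x = 0 := by
    refine ⟨fun h => ?_, fun ⟨h, h0⟩ => funext fun x => by rw [hT_apply, h, h0, add_zero]⟩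
    have hcard : Fintype.card X * ∑ y, f y = 0 := by
      rw [← hg, ← h]
      simp [hT_apply, Finset.sum_add_distrib, sum_generator_eq_zero hk]
    have hsum : ∑ x, f x = 0 := by
      rcases isEmpty_or_nonempty X with hX | hX
      · simp
      · simpa using hcard
    exact ⟨by rw [← h]; funext x; rw [hT_apply, hsum, add_zero], hsum⟩
  have hinj : Function.Injective T := LinearMap.ker_eq_bot.mp <| LinearMap.ker_eq_bot'.mpr
    fun f hf => by
      obtain ⟨hgen, hsum⟩ := (hT (by simp)).mp hf
      exact eq_zero_of_generator_eq_zero hk hirr hgen hsum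
  simpa only [hT hg] using
    Function.Bijective.existsUnique ⟨hinj, LinearMap.surjective_of_injective hinj⟩ g

end Network

section Poincare

variable {X K : Type*} {k w : X → X → ℝ} {C ρ : ℝ}

lemma mul_sq_sub_le_of_two_step_paths {s t : Finset X} (hst : s ⊆ t) {x y : X} {θ : ℝ}
    (hρ : 0 ≤ ρ) (hk : ∀ x y, 0 ≤ k x y) (hwx : ∀ z ∈ s, w x z ∈ Set.Icc 0 C)
    (hwy : ∀ z ∈ s, w y z ∈ Set.Icc 0 C) (hwkx : ∀ z ∈ s, w x z ≤ ρ * k x z)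
    (hwky : ∀ z ∈ s, w y z ≤ ρ * k y z) (hC : 0 ≤ C) (hθ : θ ≤ ∑ z ∈ s, w x z * w y z)
    (f : X → ℝ) :
    θ * (f x - f y) ^ 2 ≤
      2 * C * ρ * (∑ z ∈ t, (f x - f z) ^ 2 * k x z + ∑ z ∈ t, (f y - f z) ^ 2 * k y z) := by
  have hstep : ∀ z ∈ s, w x z * w y z * (f x - f y) ^ 2 ≤
      2 * C * ρ * ((f x - f z) ^ 2 * k x z + (f y - f z) ^ 2 * k y z) := fun z hz => by
    have hsq : (f x - f y) ^ 2 ≤ 2 * ((f x - f z) ^ 2 + (f y - f z) ^ 2) := by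
      nlinarith [sq_nonneg (f x - f z + (f y - f z))]
    have hx : w x z * w y z ≤ C * (ρ * k x z) := by
      rw [mul_comm]
      exact mul_le_mul (hwy z hz).2 (hwkx z hz) (hwx z hz).1 hC
    have hy : w x z * w y z ≤ C * (ρ * k y z) :=
      mul_le_mul (hwx z hz).2 (hwky z hz) (hwy z hz).1 hC
    calc w x z * w y z * (f x - f y) ^ 2
        ≤ w x z * w y z * (2 * ((f x - f z) ^ 2 + (f y - f z) ^ 2)) := by
          gcongr
          exact mul_nonneg (hwx z hz).1 (hwy z hz).1
      _ = 2 * (w x z * w y z * (f x - f z) ^ 2 + w x z * w y z * (f y - f z) ^ 2) := by ring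
      _ ≤ 2 * (C * (ρ * k x z) * (f x - f z) ^ 2 + C * (ρ * k y z) * (f y - f z) ^ 2) := by
          gcongr
      _ = _ := by ring
  calc θ * (f x - f y) ^ 2 ≤ (∑ z ∈ s, w x z * w y z) * (f x - f y) ^ 2 := by gcongr
    _ ≤ ∑ z ∈ s, 2 * C * ρ * ((f x - f z) ^ 2 * k x z + (f y - f z) ^ 2 * k y z) := by
        rw [Finset.sum_mul]
        exact Finset.sum_le_sum hstep
    _ ≤ ∑ z ∈ t, 2 * C * ρ * ((f x - f z) ^ 2 * k x z + (f y - f z) ^ 2 * k y z) := by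
        refine Finset.sum_le_sum_of_subset_of_nonneg hst fun z _ _ => ?_
        have := hk x z
        have := hk y z
        positivity
    _ = _ := by rw [← Finset.mul_sum, Finset.sum_add_distrib]

variable [Fintype X] [DecidableEq K] {c : X → K}

lemma sum_sum_block_le_two_mul_dirichlet (hk : ∀ x y, 0 ≤ k x y) (f : X → ℝ) :
    ∑ x, ∑ z with c z = c x, (f x - f z) ^ 2 * k x z ≤ 2 * dirichlet k f := by
  rw [dirichlet, ← mul_assoc, mul_one_div_cancel two_ne_zero, one_mul]
  exact Finset.sum_le_sum fun x _ => Finset.sum_le_sum_of_subset_of_nonneg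
    (Finset.filter_subset _ _) fun z _ _ => mul_nonneg (sq_nonneg _) (hk x z)

lemma sum_sum_block_add {N : ℕ} (hN : ∀ x, Finset.card {y | c y = c x} = N) (g : X → ℝ) :
    ∑ x, ∑ y with c y = c x, (g x + g y) = 2 * (N * ∑ x, g x) := by
  have hfst : ∑ x, ∑ y with c y = c x, g x = N * ∑ x, g x := by
    simp only [Finset.sum_const, hN, nsmul_eq_mul, Finset.mul_sum]
  have hsnd : ∑ x, ∑ y with c y = c x, g y = N * ∑ x, g x := by
    rw [← hfst]
    simp only [Finset.sum_filter]
    rw [Finset.sum_comm]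
    simp only [eq_comm]
  simp only [Finset.sum_add_distrib]
  linarith

variable [DecidableEq X]

lemma mul_sq_sub_le_of_block_paths {N : ℝ} (hC : 0 ≤ C) (hρ : 0 ≤ ρ) (hk : ∀ x y, 0 ≤ k x y)
    (hw : ∀ x y, x ≠ y → w x y ∈ Set.Icc 0 C)
    (hwk : ∀ x y, x ≠ y → c x = c y → w x y ≤ ρ * k x y)
    (hpath : ∀ x y, x ≠ y → c x = c y →
      N ≤ ∑ z with c z = c x ∧ z ≠ x ∧ z ≠ y, w x z * w y z) (f : X → ℝ) {x y : X}
    (hxy : c y = c x) :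
    N * (f x - f y) ^ 2 ≤ 2 * C * ρ * (∑ z with c z = c x, (f x - f z) ^ 2 * k x z +
      ∑ z with c z = c y, (f y - f z) ^ 2 * k y z) := by
  rcases eq_or_ne x y with rfl | hne
  · have hsum : 0 ≤ ∑ z with c z = c x, (f x - f z) ^ 2 * k x z :=
      Finset.sum_nonneg fun z _ => mul_nonneg (sq_nonneg _) (hk x z)
    rw [sub_self, zero_pow two_ne_zero, mul_zero]
    exact mul_nonneg (by positivity) (add_nonneg hsum hsum)
  have hmem (z : X) (hz : z ∈ ({z | c z = c x ∧ z ≠ x ∧ z ≠ y} : Finset X)) :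
      c x = c z ∧ x ≠ z ∧ y ≠ z := by
    obtain ⟨hzx, hx, hy⟩ := (Finset.mem_filter.mp hz).2
    exact ⟨hzx.symm, hx.symm, hy.symm⟩
  rw [hxy]
  exact mul_sq_sub_le_of_two_step_paths (Finset.monotone_filter_right _ fun z _ hz => hz.1) hρ hk
    (fun z hz => hw _ _ (hmem z hz).2.1) (fun z hz => hw _ _ (hmem z hz).2.2)
    (fun z hz => hwk _ _ (hmem z hz).2.1 (hmem z hz).1)
    (fun z hz => hwk _ _ (hmem z hz).2.2 (hxy.trans (hmem z hz).1)) hC (hpath x y hne hxy.symm) f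

/-- The Poincaré inequality on blocks of `N` points: it suffices that any two points of a block be
joined by many two-step paths inside the block. -/
theorem sum_sq_sub_blockAvg_le {N : ℕ} (hN : ∀ x, Finset.card {y | c y = c x} = N) (hC : 0 ≤ C)
    (hρ : 0 ≤ ρ) (hk : ∀ x y, 0 ≤ k x y) (hw : ∀ x y, x ≠ y → w x y ∈ Set.Icc 0 C)
    (hwk : ∀ x y, x ≠ y → c x = c y → w x y ≤ ρ * k x y)
    (hpath : ∀ x y, x ≠ y → c x = c y →
      (N : ℝ) / 4 ≤ ∑ z with c z = c x ∧ z ≠ x ∧ z ≠ y, w x z * w y z) (f : X → ℝ) :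
    ∑ x, (f x - blockAvg c f x) ^ 2 ≤ 32 * C * (ρ / N) * dirichlet k f := by
  rcases isEmpty_or_nonempty X with hX | ⟨⟨x₀⟩⟩
  · simp [dirichlet]
  have hNpos : (0 : ℝ) < N := hN x₀ ▸ card_block_pos c x₀
  let e (x : X) : ℝ := ∑ z with c z = c x, (f x - f z) ^ 2 * k x z
  have hpair (x y : X) (hxy : c y = c x) : (f x - f y) ^ 2 ≤ 8 * C * (ρ / N) * (e x + e y) := by
    refine (le_div_iff₀' (by positivity : (0 : ℝ) < N / 4)).mpr
      (mul_sq_sub_le_of_block_paths hC hρ hk hw hwk hpath f hxy) |>.trans_eq ?_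
    simp only [e]
    field_simp
    ring
  calc ∑ x, (f x - blockAvg c f x) ^ 2
      ≤ ∑ x, (∑ y with c y = c x, (f x - f y) ^ 2) / N :=
        Finset.sum_le_sum fun x _ => by simpa only [hN] using sq_sub_blockAvg_le c f x
    _ ≤ ∑ x, (∑ y with c y = c x, 8 * C * (ρ / N) * (e x + e y)) / N := by
        gcongr with x _ y hy
        exact hpair x y (Finset.mem_filter.mp hy).2
    _ = 16 * C * (ρ / N) * ∑ x, e x := by
        simp only [← Finset.sum_div, ← Finset.mul_sum]
        rw [sum_sum_block_add hN]
        field_simp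
        ring
    _ ≤ 16 * C * (ρ / N) * (2 * dirichlet k f) := by
        gcongr
        exact sum_sum_block_le_two_mul_dirichlet hk f
    _ = _ := by ring

end Poincare

section Concentration

open scoped NNReal

variable {Ω ι κ : Type*} [MeasurableSpace Ω] {P : Measure Ω} {X : ι → Ω → ℝ} {C : ℝ}

/-- The random variables `X i` are independent, of mean one, and take values in `[0, C]`. They need
not be identically distributed. -/
structure IsIndepMeanOne (P : Measure Ω) (X : ι → Ω → ℝ) (C : ℝ) : Prop where
  measurable : ∀ i, Measurable (X i)
  indep : iIndepFun X P
  mem_Icc : ∀ i, ∀ᵐ ω ∂P, X i ω ∈ Set.Icc 0 C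
  integral_eq_one : ∀ i, ∫ ω, X i ω ∂P = 1

lemma hasSubgaussianMGF_mono {Y : Ω → ℝ} {c c' : ℝ≥0} (hY : HasSubgaussianMGF Y c P)
    (hc : c ≤ c') : HasSubgaussianMGF Y c' P :=
  ⟨hY.integrable_exp_mul, fun t => (hY.mgf_le t).trans <| by gcongr⟩

lemma iIndepFun_curry {𝓧 : Type*} [MeasurableSpace 𝓧] {Y : ι → κ → Ω → 𝓧}
    (hm : ∀ i j, Measurable (Y i j)) (hY : iIndepFun (fun p : ι × κ => Y p.1 p.2) P) :
    iIndepFun (fun i ω j => Y i j ω) P := by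
  have := hY.isProbabilityMeasure
  have (i : ι) (j : κ) : IsProbabilityMeasure (P.map (Y i j)) :=
    Measure.isProbabilityMeasure_map (hm i j).aemeasurable
  have hrow (i : ι) : P.map (fun ω j => Y i j ω) = Measure.infinitePi fun j => P.map (Y i j) :=
    (hY.precomp (Prod.mk_right_injective i)).map_fun_eq_infinitePi_map (hm i)
  have hjoint : P.map (fun ω i j => Y i j ω) =
      (P.map fun ω (p : ι × κ) => Y p.1 p.2 ω).map (MeasurableEquiv.curry ι κ 𝓧) := by
    rw [Measure.map_map (by fun_prop) (by fun_prop)]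
    rfl
  rw [iIndepFun_iff_map_fun_eq_infinitePi_map (by fun_prop), hjoint,
    hY.map_fun_eq_infinitePi_map (by fun_prop),
    Measure.infinitePi_map_curry fun i j => P.map (Y i j)]
  simp only [hrow]

namespace IsIndepMeanOne

lemma precomp (hX : IsIndepMeanOne P X C) {g : κ → ι} (hg : g.Injective) :
    IsIndepMeanOne P (fun j => X (g j)) C where
  measurable j := hX.measurable (g j)
  indep := hX.indep.precomp hg
  mem_Icc j := hX.mem_Icc (g j)
  integral_eq_one j := hX.integral_eq_one (g j)

lemma one_le (hX : IsIndepMeanOne P X C) (i : ι) : 1 ≤ C := by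
  have := hX.indep.isProbabilityMeasure
  have hint : Integrable (X i) P :=
    .of_mem_Icc 0 C (hX.measurable i).aemeasurable (hX.mem_Icc i)
  calc 1 = ∫ ω, X i ω ∂P := (hX.integral_eq_one i).symm
    _ ≤ ∫ _, C ∂P := integral_mono_ae hint (integrable_const C) <| by
        filter_upwards [hX.mem_Icc i] with ω hω using hω.2
    _ = C := by simp

lemma prod [Fintype κ] {X : ι → κ → Ω → ℝ}
    (hX : IsIndepMeanOne P (fun p : ι × κ => X p.1 p.2) C) :
    IsIndepMeanOne P (fun i ω => ∏ j, X i j ω) (C ^ Fintype.card κ) where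
  measurable i := Finset.measurable_fun_prod _ fun j _ => hX.measurable (i, j)
  indep := (iIndepFun_curry (fun i j => hX.measurable (i, j)) hX.indep).comp
    (fun _ x => ∏ j, x j) fun _ => by fun_prop
  mem_Icc i := by
    filter_upwards [ae_all_iff.mpr fun j => hX.mem_Icc (i, j)] with ω hω
    refine ⟨Finset.prod_nonneg fun j _ => (hω j).1, ?_⟩
    calc ∏ j, X i j ω ≤ ∏ _j : κ, C :=
          Finset.prod_le_prod (fun j _ => (hω j).1) fun j _ => (hω j).2
      _ = C ^ Fintype.card κ := by rw [Finset.prod_const, Finset.card_univ]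
  integral_eq_one i := by
    rw [(hX.indep.precomp (Prod.mk_right_injective i)).integral_fun_prod_eq_prod_integral
      fun j => (hX.measurable (i, j)).aestronglyMeasurable]
    exact Finset.prod_eq_one fun j _ => hX.integral_eq_one (i, j)

lemma hasSubgaussianMGF (hX : IsIndepMeanOne P X C) (i : ι) :
    HasSubgaussianMGF (fun ω => X i ω - 1) ((‖C‖₊ / 2) ^ 2) P := by
  have := hX.indep.isProbabilityMeasure
  simpa only [hX.integral_eq_one i, sub_zero] using
    hasSubgaussianMGF_of_mem_Icc (hX.measurable i).aemeasurable (hX.mem_Icc i)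

variable [Fintype ι]

lemma hasSubgaussianMGF_sum (hX : IsIndepMeanOne P X C) {a : ι → ℝ} {S : ℝ}
    (hS : ∑ i, a i ^ 2 ≤ S) :
    HasSubgaussianMGF (fun ω => ∑ i, a i * (X i ω - 1)) (S * C ^ 2 / 4).toNNReal P := by
  have hindep : iIndepFun (fun i ω => a i * (X i ω - 1)) P :=
    hX.indep.comp (fun i x => a i * (x - 1)) fun i => by fun_prop
  have hsum := HasSubgaussianMGF.sum_of_iIndepFun hindep (s := Finset.univ)
    fun i _ => (hX.hasSubgaussianMGF i).const_mul (a i)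
  have hS0 : 0 ≤ S := (Finset.sum_nonneg fun i _ => sq_nonneg (a i)).trans hS
  refine hasSubgaussianMGF_mono hsum ?_
  rw [Real.le_toNNReal_iff_coe_le (by positivity), NNReal.coe_sum]
  change ∑ i, a i ^ 2 * (‖C‖ / 2) ^ 2 ≤ S * C ^ 2 / 4
  calc ∑ i, a i ^ 2 * (‖C‖ / 2) ^ 2 = (∑ i, a i ^ 2) * C ^ 2 / 4 := by
        rw [← Finset.sum_mul, div_pow, Real.norm_eq_abs, sq_abs]
        ring
    _ ≤ S * C ^ 2 / 4 := by gcongr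

/-- Hoeffding's inequality. -/
theorem measureReal_abs_sum_ge_le (hX : IsIndepMeanOne P X C) {a : ι → ℝ} {S : ℝ}
    (hS : ∑ i, a i ^ 2 ≤ S) {ε : ℝ} (hε : 0 ≤ ε) :
    P.real {ω | ε ≤ |∑ i, a i * (X i ω - 1)|} ≤ 2 * Real.exp (-(2 * ε ^ 2) / (S * C ^ 2)) := by
  have := hX.indep.isProbabilityMeasure
  have hS0 : 0 ≤ S := (Finset.sum_nonneg fun i _ => sq_nonneg (a i)).trans hS
  have hsub := hX.hasSubgaussianMGF_sum hS
  have hexp : -ε ^ 2 / (2 * ((S * C ^ 2 / 4).toNNReal : ℝ)) = -(2 * ε ^ 2) / (S * C ^ 2) := by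
    rw [Real.coe_toNNReal _ (by positivity)]
    ring
  calc P.real {ω | ε ≤ |∑ i, a i * (X i ω - 1)|}
      ≤ P.real ({ω | ε ≤ ∑ i, a i * (X i ω - 1)} ∪
          {ω | ε ≤ (-fun ω => ∑ i, a i * (X i ω - 1)) ω}) :=
        measureReal_mono fun ω hω => by
          simp only [Set.mem_union, Set.mem_ofPred_eq] at hω ⊢
          exact le_abs.mp hω
    _ ≤ _ := measureReal_union_le _ _
    _ ≤ Real.exp (-(2 * ε ^ 2) / (S * C ^ 2)) + Real.exp (-(2 * ε ^ 2) / (S * C ^ 2)) := by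
        rw [← hexp]
        exact add_le_add (hsub.measure_ge_le hε) (hsub.neg.measure_ge_le hε)
    _ = _ := (two_mul _).symm

lemma measureReal_sum_le_half_card (hX : IsIndepMeanOne P X C) :
    P.real {ω | ∑ i, X i ω ≤ (Fintype.card ι : ℝ) / 2} ≤
      2 * Real.exp (-Fintype.card ι / (2 * C ^ 2)) := by
  have := hX.indep.isProbabilityMeasure
  calc P.real {ω | ∑ i, X i ω ≤ (Fintype.card ι : ℝ) / 2}
      ≤ P.real {ω | (Fintype.card ι : ℝ) / 2 ≤ |∑ i, 1 * (X i ω - 1)|} := by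
        refine measureReal_mono fun ω hω => ?_
        simp only [Set.mem_ofPred_eq] at hω ⊢
        refine le_abs.mpr <| .inr ?_
        simp only [one_mul, Finset.sum_sub_distrib, Finset.sum_const, Finset.card_univ,
          nsmul_eq_mul, mul_one]
        linarith
    _ ≤ 2 * Real.exp (-(2 * ((Fintype.card ι : ℝ) / 2) ^ 2) / (Fintype.card ι * C ^ 2)) :=
        hX.measureReal_abs_sum_ge_le (by simp) (by positivity)
    _ = _ := by
        congr 2
        rcases (Fintype.card ι).eq_zero_or_pos with h | h
        · simp [h]
        · field_simp

end IsIndepMeanOne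

end Concentration

section Geometry

variable {d : ℕ}

@[simp] lemma toEuclidean_apply (z : Lattice d) (i : Fin d) : toEuclidean z i = z i := rfl

@[simp] lemma toEuclidean_zero : toEuclidean (0 : Lattice d) = 0 := by
  ext i
  simp

lemma toEuclidean_neg (z : Lattice d) : toEuclidean (-z) = -toEuclidean z := by
  ext i
  simp

lemma toEuclidean_injective : Function.Injective (toEuclidean (d := d)) := fun x y h => by
  funext i
  simpa using congrArg (fun v : EuclideanSpace ℝ (Fin d) => v i) h

lemma norm_toEuclidean_le {z : Lattice d} {R : ℝ} (hR : 0 ≤ R) (h : ∀ i, |(z i : ℝ)| ≤ R) :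
    ‖toEuclidean z‖ ≤ d * R := by
  rw [EuclideanSpace.norm_eq]
  refine Real.sqrt_le_iff.mpr ⟨by positivity, ?_⟩
  calc ∑ i, ‖toEuclidean z i‖ ^ 2 ≤ ∑ _i : Fin d, R ^ 2 := by
        refine Finset.sum_le_sum fun i _ => ?_
        rw [toEuclidean_apply, Real.norm_eq_abs]
        gcongr
        exact h i
    _ = d * R ^ 2 := by simp
    _ ≤ (d : ℝ) ^ 2 * R ^ 2 := by
        gcongr
        exact_mod_cast Nat.le_self_pow two_ne_zero d
    _ = (d * R) ^ 2 := by ring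

/-- The integrability weight `|z|^{-(d+α-1)}` of the drift, equal to `0` at `z = 0` if `α > 1`. -/
noncomputable def decay (α : ℝ) (z : Lattice d) : ℝ := ‖toEuclidean z‖ ^ (1 - ((d : ℝ) + α))

lemma decay_nonneg (α : ℝ) (z : Lattice d) : 0 ≤ decay α z := by
  unfold decay
  positivity

lemma toEuclidean_mem_span {b : Module.Basis (Fin d) ℝ (EuclideanSpace ℝ (Fin d))}
    (hb : ∀ i, b i = EuclideanSpace.single i 1) (z : Lattice d) :
    toEuclidean z ∈ Submodule.span ℤ (Set.range b) := by
  have hz : toEuclidean z = ∑ i, z i • b i := by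
    ext j
    simp [hb, Pi.single_apply]
  rw [hz]
  exact Submodule.sum_mem _ fun i _ =>
    Submodule.smul_mem _ _ (Submodule.subset_span (Set.mem_range_self i))

lemma summable_norm_rpow_span (b : Module.Basis (Fin d) ℝ (EuclideanSpace ℝ (Fin d))) {r : ℝ}
    (hr : r < -d) : Summable fun v : Submodule.span ℤ (Set.range b) => ‖v‖ ^ r := by
  have hrank : Module.finrank ℤ (Submodule.span ℤ (Set.range b)) = d :=
    (Module.finrank_eq_card_basis (b.restrictScalars ℤ)).trans (Fintype.card_fin d)
  exact ZLattice.summable_norm_rpow _ r (by rwa [hrank])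

lemma summable_norm_toEuclidean_rpow {r : ℝ} (hr : r < -d) :
    Summable fun z : Lattice d => ‖toEuclidean z‖ ^ r := by
  obtain ⟨b, hb⟩ : ∃ b : Module.Basis (Fin d) ℝ (EuclideanSpace ℝ (Fin d)),
      ∀ i, b i = EuclideanSpace.single i 1 :=
    ⟨(EuclideanSpace.basisFun (Fin d) ℝ).toBasis, fun i => by simp⟩
  let j : Lattice d → Submodule.span ℤ (Set.range b) := fun z => ⟨_, toEuclidean_mem_span hb z⟩
  have hj : Function.Injective j := fun x y h => toEuclidean_injective (congrArg Subtype.val h)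
  refine ((summable_norm_rpow_span b hr).comp_injective hj).congr fun z => ?_
  rw [Function.comp_apply, Submodule.coe_norm]

lemma tsum_decay_sub (α : ℝ) (x : Lattice d) :
    ∑' y, decay α (y - x) = ∑' z : Lattice d, decay α z :=
  (Equiv.subRight x).tsum_eq (decay α)

/-- The coordinate `i` of the drift coefficient `z / |z|^{d+α}`. -/
noncomputable def driftCoeff (α : ℝ) (i : Fin d) (z : Lattice d) : ℝ :=
  z i / ‖toEuclidean z‖ ^ ((d : ℝ) + α)

lemma driftCoeff_neg (α : ℝ) (i : Fin d) (z : Lattice d) :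
    driftCoeff α i (-z) = -driftCoeff α i z := by
  simp [driftCoeff, toEuclidean_neg, neg_div]

lemma tsum_driftCoeff (α : ℝ) (i : Fin d) : ∑' z, driftCoeff α i z = 0 := by
  have h : ∑' z, driftCoeff α i (-z) = ∑' z, driftCoeff α i z :=
    (Equiv.neg (Lattice d)).tsum_eq (driftCoeff α i)
  simp only [driftCoeff_neg, tsum_neg] at h
  linarith

/-- The conductances `w` take values in `[0, C]` off the diagonal. -/
def BoundedBy (w : Sym2 (Lattice d) → ℝ) (C : ℝ) : Prop :=
  ∀ x y, x ≠ y → w s(x, y) ∈ Set.Icc 0 C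

lemma BoundedBy.abs_sub_one_le {w : Sym2 (Lattice d) → ℝ} {C : ℝ} (hw : BoundedBy w C)
    {x y : Lattice d} (hxy : x ≠ y) : |w s(x, y) - 1| ≤ C + 1 := by
  obtain ⟨h0, hC⟩ := hw x y hxy
  rw [abs_le]
  constructor <;> linarith

section Drift

variable {α : ℝ} (hα : 1 < α)

include hα

lemma summable_decay : Summable (decay α : Lattice d → ℝ) :=
  summable_norm_toEuclidean_rpow (by linarith)

lemma summable_decay_sub (x : Lattice d) : Summable fun y => decay α (y - x) :=
  (Equiv.subRight x).summable_iff.mpr (summable_decay hα)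

lemma sum_sq_decay_sub_le (F : Finset (Lattice d)) (x : Lattice d) :
    ∑ y ∈ F, decay α (y - x) ^ 2 ≤ (∑' z : Lattice d, decay α z) ^ 2 := by
  calc ∑ y ∈ F, decay α (y - x) ^ 2 ≤ (∑ y ∈ F, decay α (y - x)) ^ 2 :=
        Finset.sum_sq_le_sq_sum_of_nonneg fun y _ => decay_nonneg α _
    _ ≤ (∑' z : Lattice d, decay α z) ^ 2 := by
        rw [← tsum_decay_sub α x]
        gcongr
        · exact Finset.sum_nonneg fun y _ => decay_nonneg α _
        · exact (summable_decay_sub hα x).sum_le_tsum _ fun y _ => decay_nonneg α _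

lemma norm_smul_toEuclidean_le {a C : ℝ} {z : Lattice d} (ha : z ≠ 0 → |a| ≤ C) :
    ‖(a / ‖toEuclidean z‖ ^ ((d : ℝ) + α)) • toEuclidean z‖ ≤ C * decay α z := by
  rcases eq_or_ne z 0 with rfl | hz
  · have hr : 1 - ((d : ℝ) + α) ≠ 0 := by linarith [(Nat.cast_nonneg d : (0 : ℝ) ≤ d)]
    simp [decay, Real.zero_rpow hr]
  · have hpos : 0 < ‖toEuclidean z‖ :=
      norm_pos_iff.mpr fun h => hz <| toEuclidean_injective <| h.trans toEuclidean_zero.symm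
    rw [norm_smul, norm_div, Real.norm_eq_abs, Real.norm_of_nonneg (by positivity),
      div_mul_eq_mul_div, mul_div_assoc, decay, Real.rpow_sub hpos, Real.rpow_one]
    gcongr
    exact ha hz

lemma abs_driftCoeff_mul_le {a C : ℝ} {z : Lattice d} (i : Fin d) (ha : z ≠ 0 → |a| ≤ C) :
    |driftCoeff α i z * a| ≤ C * decay α z := by
  refine le_trans (le_of_eq_of_le ?_ (PiLp.norm_apply_le _ i)) (norm_smul_toEuclidean_le hα ha)
  rw [PiLp.smul_apply, smul_eq_mul, Real.norm_eq_abs, toEuclidean_apply, driftCoeff]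
  congr 1
  ring

lemma abs_driftCoeff_le (i : Fin d) (z : Lattice d) : |driftCoeff α i z| ≤ decay α z := by
  simpa only [mul_one, one_mul] using
    abs_driftCoeff_mul_le hα (a := 1) (C := 1) (z := z) i fun _ => abs_one.le

lemma sum_sum_sq_driftCoeff_sub_le {R : ℝ} (hR : ∑' z : Lattice d, decay α z ≤ R) (i : Fin d)
    (Q F : Finset (Lattice d)) :
    ∑ x ∈ Q, ∑ y ∈ F, driftCoeff α i (y - x) ^ 2 ≤ Q.card * R ^ 2 := by
  calc ∑ x ∈ Q, ∑ y ∈ F, driftCoeff α i (y - x) ^ 2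
      ≤ ∑ x ∈ Q, ∑ y ∈ F, decay α (y - x) ^ 2 :=
        Finset.sum_le_sum fun x _ => Finset.sum_le_sum fun y _ =>
          sq_le_sq.mpr ((abs_driftCoeff_le hα i _).trans (le_abs_self _))
    _ ≤ ∑ _x ∈ Q, R ^ 2 := by
        gcongr with x _
        refine (sum_sq_decay_sub_le hα F x).trans ?_
        gcongr
        exact tsum_nonneg fun z => decay_nonneg α z
    _ = Q.card * R ^ 2 := by rw [Finset.sum_const, nsmul_eq_mul]

variable {C : ℝ} {w : Sym2 (Lattice d) → ℝ}

lemma abs_driftCoeff_mul_sub_one_le (hw : BoundedBy w C) (x y : Lattice d) (i : Fin d) :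
    |driftCoeff α i (y - x) * (w s(x, y) - 1)| ≤ (C + 1) * decay α (y - x) :=
  abs_driftCoeff_mul_le hα i fun h => hw.abs_sub_one_le (sub_ne_zero.mp h).symm

lemma summable_driftCoeff_mul_sub_one (hw : BoundedBy w C) (x : Lattice d) (i : Fin d) :
    Summable fun y => driftCoeff α i (y - x) * (w s(x, y) - 1) :=
  .of_norm_bounded ((summable_decay_sub hα x).mul_left (C + 1))
    fun y => abs_driftCoeff_mul_sub_one_le hα hw x y i

/-- Since the drift coefficient is odd, the conductances may be replaced by their fluctuations. -/
lemma drift_apply (hw : BoundedBy w C) (x : Lattice d) (i : Fin d) :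
    drift α w x i = ∑' y, driftCoeff α i (y - x) * (w s(x, y) - 1) := by
  have hs : Summable fun z : Lattice d =>
      (w s(x, x + z) / ‖toEuclidean z‖ ^ ((d : ℝ) + α)) • toEuclidean z :=
    .of_norm_bounded ((summable_decay hα).mul_left C) fun z =>
      norm_smul_toEuclidean_le hα fun hz => by
        obtain ⟨h0, hC⟩ := hw x (x + z) (by simpa using hz)
        rwa [abs_of_nonneg h0]
  have hcoord : drift α w x i = ∑' z, driftCoeff α i z * w s(x, x + z) := by
    refine ((EuclideanSpace.proj i : EuclideanSpace ℝ (Fin d) →L[ℝ] ℝ).map_tsum hs).trans ?_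
    refine tsum_congr fun z => ?_
    change w s(x, x + z) / ‖toEuclidean z‖ ^ ((d : ℝ) + α) * (z i : ℝ) = _
    rw [driftCoeff]
    ring
  have hcoeff : Summable (driftCoeff α i) :=
    .of_norm_bounded (summable_decay hα) (abs_driftCoeff_le hα i)
  have hfluct : Summable fun z => driftCoeff α i z * (w s(x, x + z) - 1) :=
    ((Equiv.addLeft x).summable_iff.mpr (summable_driftCoeff_mul_sub_one hα hw x i)).congr
      fun z => by simp
  calc drift α w x i
      = ∑' z, (driftCoeff α i z * (w s(x, x + z) - 1) + driftCoeff α i z) := by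
        rw [hcoord]
        exact tsum_congr fun z => by ring
    _ = ∑' z, driftCoeff α i z * (w s(x, x + z) - 1) := by
        rw [hfluct.tsum_add hcoeff, tsum_driftCoeff, add_zero]
    _ = ∑' y, driftCoeff α i (y - x) * (w s(x, y) - 1) := by
        rw [← (Equiv.addLeft x).tsum_eq fun y => driftCoeff α i (y - x) * (w s(x, y) - 1)]
        simp

lemma abs_drift_apply_le (hw : BoundedBy w C) (x : Lattice d) (i : Fin d) :
    |drift α w x i| ≤ (C + 1) * ∑' z : Lattice d, decay α z := by
  rw [drift_apply hα hw, ← tsum_decay_sub α x, ← tsum_mul_left, ← Real.norm_eq_abs]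
  exact tsum_of_norm_bounded
    ((summable_decay_sub hα x).mul_left (C + 1)).hasSum
    fun y => abs_driftCoeff_mul_sub_one_le hα hw x y i

lemma abs_drift_sub_sum_le (hw : BoundedBy w C) (G : Finset (Lattice d)) (x : Lattice d)
    (i : Fin d) :
    |drift α w x i - ∑ y ∈ G, driftCoeff α i (y - x) * (w s(x, y) - 1)| ≤
      (C + 1) * ∑' y : {y // y ∉ G}, decay α (y.1 - x) := by
  rw [drift_apply hα hw, ← (summable_driftCoeff_mul_sub_one hα hw x i).sum_add_tsum_subtype_compl G,
    add_sub_cancel_left, ← tsum_mul_left, ← Real.norm_eq_abs]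
  exact tsum_of_norm_bounded
    (((summable_decay_sub hα x).mul_left (C + 1)).subtype {y | y ∉ G}).hasSum
    fun y => abs_driftCoeff_mul_sub_one_le hα hw x y.1 i

end Drift

/-- The drifts of two points of `Q` cancel along the edge which joins them, so that only the edges
leaving `Q` contribute to the total drift of `Q`. -/
lemma sum_sum_driftCoeff_mul_eq (α : ℝ) (w : Sym2 (Lattice d) → ℝ) {Q G : Finset (Lattice d)}
    (hQG : Q ⊆ G) (i : Fin d) :
    ∑ x ∈ Q, ∑ y ∈ G, driftCoeff α i (y - x) * (w s(x, y) - 1) =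
      ∑ x ∈ Q, ∑ y ∈ G \ Q, driftCoeff α i (y - x) * (w s(x, y) - 1) := by
  have hcancel : ∑ x ∈ Q, ∑ y ∈ Q, driftCoeff α i (y - x) * (w s(x, y) - 1) = 0 := by
    have hanti : ∑ x ∈ Q, ∑ y ∈ Q, driftCoeff α i (y - x) * (w s(x, y) - 1) =
        -∑ x ∈ Q, ∑ y ∈ Q, driftCoeff α i (y - x) * (w s(x, y) - 1) := by
      conv_lhs => rw [Finset.sum_comm]
      simp only [← Finset.sum_neg_distrib]
      refine Finset.sum_congr rfl fun x _ => Finset.sum_congr rfl fun y _ => ?_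
      rw [← neg_sub y x, driftCoeff_neg, Sym2.eq_swap, neg_mul]
    linarith
  simp only [← Finset.sum_sdiff hQG, Finset.sum_add_distrib, hcancel, add_zero]

lemma exists_forall_abs_sum_drift_sub_le {α : ℝ} (hα : 1 < α) (Q : Finset (Lattice d)) (C : ℝ)
    {δ : ℝ} (hδ : 0 < δ) :
    ∃ G : Finset (Lattice d), ∀ w, BoundedBy w C → ∀ i,
      |∑ x ∈ Q, drift α w x i -
        ∑ x ∈ Q, ∑ y ∈ G \ Q, driftCoeff α i (y - x) * (w s(x, y) - 1)| ≤ δ := by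
  have htail : Filter.Tendsto (fun G : Finset (Lattice d) =>
      ∑ x ∈ Q, (C + 1) * ∑' y : {y // y ∉ G}, decay α (y.1 - x)) Filter.atTop (nhds 0) := by
    simpa only [mul_zero, Finset.sum_const_zero] using tendsto_finsetSum Q fun x _ =>
      (tendsto_tsum_compl_atTop_zero fun y => decay α (y - x)).const_mul (C + 1)
  obtain ⟨G, hG, hQG⟩ :=
    ((htail.eventually_le_const hδ).and (Filter.eventually_ge_atTop Q)).exists
  refine ⟨G, fun w hw i => ?_⟩
  rw [← sum_sum_driftCoeff_mul_eq α w hQG, ← Finset.sum_sub_distrib]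
  exact (Finset.abs_sum_le_sum_abs _ _).trans <|
    (Finset.sum_le_sum fun x _ => abs_drift_sub_sum_le hα hw G x i).trans hG

end Geometry

section Cells

variable {d : ℕ}

/-- The index of the dyadic cell of side `2^n` containing `x`, for the dyadic partitions of the
cube `(-2^m, 2^m]^d`; the cell of side `2^{m+1}` is the whole cube. -/
def cell (m n : ℕ) (x : Lattice d) : Lattice d := fun i => (x i - 1 + 2 ^ m) / 2 ^ n

/-- The dyadic cell of side `2^n` containing `x`, as a set of points. -/
noncomputable def block (m n : ℕ) (x : Lattice d) : Finset (Lattice d) :=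
  (box d (2 ^ m)).filter fun y => cell m n y = cell m n x

lemma mem_box {R : ℤ} {x : Lattice d} : x ∈ box d R ↔ ∀ i, x i ∈ Finset.Ioc (-R) R :=
  Fintype.mem_piFinset

lemma cell_succ (m n : ℕ) {x y : Lattice d} (h : cell m n x = cell m n y) :
    cell m (n + 1) x = cell m (n + 1) y := by
  have hdiv (z : Lattice d) (i : Fin d) : cell m (n + 1) z i = cell m n z i / 2 := by
    rw [cell, cell, pow_succ, Int.ediv_ediv_of_nonneg (by positivity)]
  funext i
  rw [hdiv, hdiv, h]

lemma cell_eq_of_le {m n k : ℕ} (hnk : n ≤ k) {x y : Lattice d} (h : cell m n x = cell m n y) :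
    cell m k x = cell m k y :=
  Nat.le_induction h (fun k _ => cell_succ m k) k hnk

lemma cell_top (m : ℕ) {x : Lattice d} (hx : x ∈ box d (2 ^ m)) : cell m (m + 1) x = 0 := by
  funext i
  obtain ⟨hlo, hhi⟩ := Finset.mem_Ioc.mp (mem_box.mp hx i)
  refine Int.ediv_eq_zero_of_lt (by linarith) ?_
  rw [pow_succ]
  linarith

lemma cell_apply_eq_iff {m n : ℕ} {y : Lattice d} {i : Fin d} {q : ℤ} :
    cell m n y i = q ↔
      y i ∈ Finset.Ico (q * 2 ^ n + 1 - 2 ^ m) (q * 2 ^ n + 1 - 2 ^ m + 2 ^ n) := by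
  rw [cell, Int.ediv_eq_iff_of_pos (by positivity), Finset.mem_Ico]
  constructor <;> rintro ⟨hlo, hhi⟩ <;> constructor <;> linarith

lemma norm_sub_le_of_cell_eq {m n : ℕ} {x y : Lattice d} (h : cell m n x = cell m n y) :
    ‖toEuclidean (x - y)‖ ≤ d * 2 ^ n := by
  refine norm_toEuclidean_le (by positivity) fun i => ?_
  obtain ⟨hxlo, hxhi⟩ := Finset.mem_Ico.mp (cell_apply_eq_iff.mp (congrFun h i))
  obtain ⟨hylo, hyhi⟩ := Finset.mem_Ico.mp (cell_apply_eq_iff.mp (rfl : cell m n y i = _))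
  have hlt : |x i - y i| ≤ 2 ^ n := by
    rw [abs_le]
    constructor <;> linarith
  exact_mod_cast hlt

lemma mem_box_of_cell_eq {m n : ℕ} (hn : n ≤ m + 1) {x y : Lattice d} (hx : x ∈ box d (2 ^ m))
    (h : cell m n y = cell m n x) : y ∈ box d (2 ^ m) := by
  have htop : cell m (m + 1) y = 0 := (cell_eq_of_le hn h).trans (cell_top m hx)
  refine mem_box.mpr fun i => ?_
  have hi := cell_apply_eq_iff.mp (congrFun htop i)
  rw [pow_succ, Pi.zero_apply, Finset.mem_Ico] at hi
  rw [Finset.mem_Ioc]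
  constructor <;> linarith [hi.1, hi.2]

lemma card_block {m n : ℕ} (hn : n ≤ m + 1) {x : Lattice d} (hx : x ∈ box d (2 ^ m)) :
    (block m n x).card = 2 ^ (n * d) := by
  have hblock : block m n x = Fintype.piFinset fun i : Fin d =>
      Finset.Ico (cell m n x i * 2 ^ n + 1 - 2 ^ m)
        (cell m n x i * 2 ^ n + 1 - 2 ^ m + 2 ^ n) := by
    ext y
    simp only [block, Finset.mem_filter, Fintype.mem_piFinset, ← cell_apply_eq_iff, ← funext_iff]
    exact and_iff_right_of_imp fun h => mem_box_of_cell_eq hn hx h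
  have hside : ((2 : ℤ) ^ n).toNat = 2 ^ n := by exact_mod_cast Int.toNat_natCast (2 ^ n)
  simp only [hblock, Fintype.card_piFinset, Int.card_Ico, add_sub_cancel_left, hside,
    Finset.prod_const, Finset.card_univ, Fintype.card_fin, ← pow_mul]

lemma box_nonempty (d m : ℕ) : (box d (2 ^ m)).Nonempty :=
  ⟨0, mem_box.mpr fun _ => Finset.mem_Ioc.mpr ⟨by simp, by positivity⟩⟩

lemma card_box (d m : ℕ) : (box d (2 ^ m)).card = 2 ^ ((m + 1) * d) := by
  obtain ⟨x, hx⟩ := box_nonempty d m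
  rw [← card_block le_rfl hx, block, Finset.filter_true_of_mem fun y hy => by
    rw [cell_top m hy, cell_top m hx]]

end Cells

section GoodScales

variable {d : ℕ}

/-- The conductances `w` are typical at scale `2^n` in the cube `(-2^m, 2^m]^d`: any two points of a
dyadic cell are joined by many two-step paths of large weight inside the cell, and the drift of each
cell is at most `K √m` times the square root of its volume. -/
structure IsGoodScale (α : ℝ) (w : Sym2 (Lattice d) → ℝ) (K : ℝ) (m n : ℕ) : Prop where
  paths : ∀ x ∈ box d (2 ^ m), ∀ y ∈ box d (2 ^ m), x ≠ y → cell m n x = cell m n y →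
    (2 : ℝ) ^ (n * d) / 4 ≤ ∑ z ∈ block m n x with z ≠ x ∧ z ≠ y, w s(x, z) * w s(y, z)
  drift : ∀ x ∈ box d (2 ^ m), ∀ i : Fin d,
    |∑ u ∈ block m n x, drift α w u i| ≤ K * √m * √((2 : ℝ) ^ (n * d))

variable {Ω : Type*} [MeasurableSpace Ω] {P : Measure Ω} {w : Sym2 (Lattice d) → Ω → ℝ} {C : ℝ}

lemma exists_injective_edge_path {x y : Lattice d} (hxy : x ≠ y) {T : Finset (Lattice d)}
    (hT : ∀ z ∈ T, z ≠ x ∧ z ≠ y) :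
    ∃ g : T × Fin 2 → Edge d, Function.Injective g ∧
      ∀ z : T, (g (z, 0) : Sym2 _) = s(x, z.1) ∧ (g (z, 1) : Sym2 _) = s(y, z.1) := by
  have hends (z : T) (j : Fin 2) : ![x, y] j ≠ z := by
    revert j
    exact Fin.forall_fin_two.mpr ⟨(hT z z.2).1.symm, (hT z z.2).2.symm⟩
  have hpair : Function.Injective ![x, y] := by
    simpa [Fin.forall_fin_two, Function.Injective] using ⟨hxy, hxy.symm⟩
  refine ⟨fun p => ⟨s(![x, y] p.2, p.1), by simpa using hends p.1 p.2⟩, ?_, fun z => ⟨rfl, rfl⟩⟩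
  rintro ⟨z, j⟩ ⟨z', j'⟩ h
  rcases Sym2.eq_iff.mp (congrArg Subtype.val h) with ⟨hj, hz⟩ | ⟨hjz, -⟩
  · exact Prod.ext (Subtype.ext hz) (hpair hj)
  · exact (hends z' j hjz).elim

lemma measureReal_sum_paths_lt_le (hw : IsIndepMeanOne P (fun e : Edge d => w e) C)
    {Q : Finset (Lattice d)} (hQ : 4 ≤ Q.card) {x y : Lattice d} (hxy : x ≠ y) :
    P.real {ω | ∑ z ∈ Q with z ≠ x ∧ z ≠ y, w s(x, z) ω * w s(y, z) ω < (Q.card : ℝ) / 4} ≤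
      2 * Real.exp (-Q.card / (4 * C ^ 4)) := by
  have := hw.indep.isProbabilityMeasure
  set T := Q.filter fun z => z ≠ x ∧ z ≠ y
  obtain ⟨g, hg, hgs⟩ := exists_injective_edge_path hxy (T := T) fun z hz =>
    (Finset.mem_filter.mp hz).2
  have hpaths := ((hw.precomp hg).prod (X := fun z j => w (g (z, j)))).measureReal_sum_le_half_card
  have hcard : (Q.card : ℝ) ≤ Fintype.card T + 2 := by
    have hT : T = Q \ {x, y} := by
      ext z
      simp [T]
    rw [Fintype.card_coe, hT]
    exact_mod_cast (Nat.sub_le_iff_le_add.mp (Finset.le_card_sdiff {x, y} Q)).trans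
      (Nat.add_le_add_left Finset.card_le_two _)
  have hQ' : (4 : ℝ) ≤ Q.card := by exact_mod_cast hQ
  have hC : 1 ≤ C := hw.one_le ⟨s(x, y), by simpa using hxy⟩
  refine (measureReal_mono fun ω hω => ?_).trans (hpaths.trans ?_)
  · simp only [Set.mem_ofPred_eq, Fin.prod_univ_two] at hω ⊢
    have hsum : ∑ z : T, w (g (z, 0)) ω * w (g (z, 1)) ω =
        ∑ z ∈ T, w s(x, z) ω * w s(y, z) ω :=
      (Fintype.sum_congr _ _ fun z => by rw [(hgs z).1, (hgs z).2]).trans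
        (Finset.sum_coe_sort T fun z => w s(x, z) ω * w s(y, z) ω)
    rw [hsum]
    linarith
  · rw [Fintype.card_fin, ← pow_mul]
    gcongr 2 * Real.exp ?_
    calc -(Fintype.card T : ℝ) / (2 * C ^ (2 * 2)) = -(2 * Fintype.card T) / (4 * C ^ 4) := by ring
      _ ≤ -Q.card / (4 * C ^ 4) := by
          gcongr
          linarith

lemma exists_injective_edge_sdiff (Q G : Finset (Lattice d)) :
    ∃ g : Q × ↥(G \ Q) → Edge d, Function.Injective g ∧ ∀ p, (g p : Sym2 _) = s(p.1.1, p.2.1) := by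
  have hne (x : Q) (y : ↥(G \ Q)) : x.1 ≠ y.1 := fun h =>
    (Finset.mem_sdiff.mp y.2).2 (h ▸ x.2)
  refine ⟨fun p => ⟨s(p.1.1, p.2.1), by simpa using hne p.1 p.2⟩, ?_, fun p => rfl⟩
  rintro ⟨x, y⟩ ⟨x', y'⟩ h
  rcases Sym2.eq_iff.mp (congrArg Subtype.val h) with ⟨hx, hy⟩ | ⟨hxy, -⟩
  · exact Prod.ext (Subtype.ext hx) (Subtype.ext hy)
  · exact (hne x y' hxy).elim

lemma ae_boundedBy (hw : IsIndepMeanOne P (fun e : Edge d => w e) C) :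
    ∀ᵐ ω ∂P, BoundedBy (fun e => w e ω) C := by
  have : Countable (Sym2 (Lattice d)) := Quotient.countable
  filter_upwards [ae_all_iff.mpr hw.mem_Icc] with ω hω x y hxy
  exact hω ⟨s(x, y), by simpa using hxy⟩

lemma measureReal_sum_drift_ge_le {α : ℝ} (hα : 1 < α)
    (hw : IsIndepMeanOne P (fun e : Edge d => w e) C) (Q : Finset (Lattice d)) (i : Fin d)
    {R ε : ℝ} (hR : ∑' z : Lattice d, decay α z ≤ R) (hε : 0 < ε) :
    P.real {ω | ε ≤ |∑ x ∈ Q, drift α (fun e => w e ω) x i|} ≤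
      2 * Real.exp (-(ε ^ 2) / (2 * (Q.card * R ^ 2 * C ^ 2))) := by
  have := hw.indep.isProbabilityMeasure
  obtain ⟨G, hG⟩ := exists_forall_abs_sum_drift_sub_le hα Q C (half_pos hε)
  obtain ⟨g, hg, hgs⟩ := exists_injective_edge_sdiff Q G
  let a : Q × ↥(G \ Q) → ℝ := fun p => driftCoeff α i (p.2.1 - p.1.1)
  have ha : ∑ p, a p ^ 2 ≤ Q.card * R ^ 2 := by
    rw [Fintype.sum_prod_type, Finset.sum_coe_sort Q fun x =>
      ∑ y : ↥(G \ Q), driftCoeff α i (y.1 - x) ^ 2]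
    simpa only [← Finset.sum_coe_sort (G \ Q)] using sum_sum_sq_driftCoeff_sub_le hα hR i Q (G \ Q)
  have hflux (ω : Ω) : ∑ x ∈ Q, ∑ y ∈ G \ Q, driftCoeff α i (y - x) * (w s(x, y) ω - 1) =
      ∑ p, a p * (w (g p) ω - 1) := by
    simp only [a, hgs, Fintype.sum_prod_type]
    rw [← Finset.sum_coe_sort Q]
    exact Finset.sum_congr rfl fun x _ => (Finset.sum_coe_sort (G \ Q) _).symm
  calc P.real {ω | ε ≤ |∑ x ∈ Q, drift α (fun e => w e ω) x i|}
      ≤ P.real {ω | ε / 2 ≤ |∑ p, a p * (w (g p) ω - 1)|} := by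
        refine ENNReal.toReal_mono (measure_ne_top _ _) (measure_mono_ae ?_)
        filter_upwards [ae_boundedBy hw] with ω hω hmem
        have hδ := hG _ hω i
        rw [hflux] at hδ
        change ε ≤ _ at hmem
        change ε / 2 ≤ _
        linarith [abs_sub_abs_le_abs_sub (∑ x ∈ Q, drift α (fun e => w e ω) x i)
          (∑ p, a p * (w (g p) ω - 1))]
    _ ≤ 2 * Real.exp (-(2 * (ε / 2) ^ 2) / (Q.card * R ^ 2 * C ^ 2)) :=
        (hw.precomp hg).measureReal_abs_sum_ge_le ha (by positivity)
    _ = _ := by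
        congr 2
        ring

lemma measureReal_exists_mem_finset_le {ι : Type*} {S : Finset ι} {p : ι → Ω → Prop} {b : ℝ}
    (h : ∀ i ∈ S, P.real {ω | p i ω} ≤ b) : P.real {ω | ∃ i ∈ S, p i ω} ≤ S.card * b := by
  have hunion : {ω | ∃ i ∈ S, p i ω} = ⋃ i ∈ S, {ω | p i ω} := by
    ext ω
    simp
  calc P.real {ω | ∃ i ∈ S, p i ω} ≤ ∑ i ∈ S, P.real {ω | p i ω} :=
        hunion ▸ measureReal_biUnion_finset_le S _
    _ ≤ S.card * b := by
        rw [← nsmul_eq_mul]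
        exact Finset.sum_le_card_nsmul S _ b h

lemma measureReal_exists_sum_paths_lt_le (hw : IsIndepMeanOne P (fun e : Edge d => w e) C)
    (hC : 1 ≤ C) {m n : ℕ} {t : ℝ} (ht : 1 ≤ t) (hn : n ≤ m + 1)
    (hnt : 4 * C ^ 4 * t ≤ 2 ^ (n * d)) :
    P.real {ω | ∃ p ∈ box d (2 ^ m) ×ˢ box d (2 ^ m), p.1 ≠ p.2 ∧
        ∑ z ∈ block m n p.1 with z ≠ p.1 ∧ z ≠ p.2, w s(p.1, z) ω * w s(p.2, z) ω <
          (2 : ℝ) ^ (n * d) / 4} ≤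
      (2 ^ ((m + 1) * d)) ^ 2 * (2 * Real.exp (-t)) := by
  have hfour : 4 ≤ 2 ^ (n * d) := by
    have hle : (4 : ℝ) * 1 * 1 ≤ 2 ^ (n * d) :=
      le_trans (by gcongr; exact one_le_pow₀ hC) hnt
    exact_mod_cast (show (4 : ℝ) ≤ 2 ^ (n * d) by linarith)
  have hexp : -2 ^ (n * d) / (4 * C ^ 4) ≤ -t := by
    rw [neg_div, neg_le_neg_iff, le_div_iff₀ (by positivity)]
    linarith
  refine (measureReal_exists_mem_finset_le (b := 2 * Real.exp (-t)) fun p hp => ?_).trans_eq ?_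
  · by_cases hne : p.1 = p.2
    · simp only [hne, ne_eq, not_true_eq_false, false_and, Set.ofPred_false, measureReal_empty]
      positivity
    · have hcard := card_block hn (Finset.mem_product.mp hp).1
      have hp := measureReal_sum_paths_lt_le hw (Q := block m n p.1) (by rwa [hcard]) hne
      rw [hcard, Nat.cast_pow, Nat.cast_ofNat] at hp
      simp only [ne_eq, hne, not_false_eq_true, true_and]
      exact hp.trans (by gcongr)
  · rw [Finset.card_product, card_box]
    push_cast
    ring

lemma measureReal_exists_sum_drift_gt_le {α : ℝ} (hα : 1 < α)
    (hw : IsIndepMeanOne P (fun e : Edge d => w e) C) (hC : 0 < C) {R : ℝ}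
    (hR : ∑' z : Lattice d, decay α z < R) {m n : ℕ} {t ε : ℝ} (hε : 0 < ε) (hn : n ≤ m + 1)
    (hεt : 2 * R ^ 2 * C ^ 2 * t * 2 ^ (n * d) ≤ ε ^ 2) :
    P.real {ω | ∃ p ∈ box d (2 ^ m) ×ˢ (Finset.univ : Finset (Fin d)),
        ε < |∑ u ∈ block m n p.1, drift α (fun e => w e ω) u p.2|} ≤
      2 ^ ((m + 1) * d) * d * (2 * Real.exp (-t)) := by
  have := hw.indep.isProbabilityMeasure
  have hR0 : 0 < R := (tsum_nonneg (decay_nonneg α)).trans_lt hR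
  have hexp : -(ε ^ 2) / (2 * (2 ^ (n * d) * R ^ 2 * C ^ 2)) ≤ -t := by
    rw [neg_div, neg_le_neg_iff, le_div_iff₀ (by positivity)]
    linarith
  refine (measureReal_exists_mem_finset_le (b := 2 * Real.exp (-t)) fun p hp => ?_).trans_eq ?_
  · have hdrift := measureReal_sum_drift_ge_le hα hw (block m n p.1) p.2 hR.le hε
    rw [card_block hn (Finset.mem_product.mp hp).1, Nat.cast_pow, Nat.cast_ofNat] at hdrift
    refine (measureReal_mono fun ω hω => ?_).trans (hdrift.trans (by gcongr))
    change ε < _ at hω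
    exact hω.le
  · rw [Finset.card_product, card_box, Finset.card_univ, Fintype.card_fin]
    push_cast
    ring

lemma two_pow_sq_le_exp (m d : ℕ) :
    ((2 : ℝ) ^ ((m + 1) * d)) ^ 2 ≤ Real.exp (2 * d) * Real.exp (2 * d * m) := by
  have htwo : (2 : ℝ) ≤ Real.exp 1 := by linarith [Real.add_one_le_exp 1]
  calc ((2 : ℝ) ^ ((m + 1) * d)) ^ 2 ≤ (Real.exp 1 ^ ((m + 1) * d)) ^ 2 := by gcongr
    _ = Real.exp (2 * d) * Real.exp (2 * d * m) := by
        rw [← pow_mul, ← Real.exp_nat_mul, ← Real.exp_add]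
        push_cast
        ring_nf

/-- The union bound over pairs of points costs a factor `e^{2d(m+1)}`, which the constants
`4 C^4 (2d+1)` and `2 (d+1) R C` are chosen to beat. -/
lemma measureReal_not_isGoodScale_le {α : ℝ} (hα : 1 < α) (hC : 1 ≤ C)
    (hw : IsIndepMeanOne P (fun e : Edge d => w e) C) {R : ℝ}
    (hR : ∑' z : Lattice d, decay α z < R) {m n : ℕ} (hm : 1 ≤ m) (hn : n ≤ m + 1)
    (hnd : 4 * C ^ 4 * (2 * d + 1) * m ≤ (2 : ℝ) ^ (n * d)) :
    P.real {ω | ¬ IsGoodScale α (fun e => w e ω) (2 * (d + 1) * R * C) m n} ≤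
      2 * (d + 1) * Real.exp (2 * d) * Real.exp (-m) := by
  have := hw.indep.isProbabilityMeasure
  have hm' : (1 : ℝ) ≤ m := by exact_mod_cast hm
  have hR0 : 0 < R := (tsum_nonneg (decay_nonneg α)).trans_lt hR
  have hC0 : 0 < C := one_pos.trans_le hC
  set K := 2 * (d + 1) * R * C with hK
  set t := (2 * d + 1) * (m : ℝ) with ht
  have hpaths := measureReal_exists_sum_paths_lt_le hw hC
    (one_le_mul_of_one_le_of_one_le (le_add_of_nonneg_left (by positivity)) hm') hn
    ((mul_assoc _ _ _).symm.trans_le hnd)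
  have hdrift := measureReal_exists_sum_drift_gt_le hα hw hC0 hR (t := t)
    (ε := K * √m * √(2 ^ (n * d))) (by positivity) hn <| by
      rw [mul_pow, mul_pow, Real.sq_sqrt (by positivity), Real.sq_sqrt (by positivity), hK, ht]
      have hd2 : 2 * (2 * (d : ℝ) + 1) ≤ (2 * (d + 1)) ^ 2 := by
        nlinarith [(d.cast_nonneg : (0 : ℝ) ≤ d)]
      calc _ = 2 * (2 * (d : ℝ) + 1) * (R ^ 2 * C ^ 2 * m * 2 ^ (n * d)) := by ring
        _ ≤ (2 * (d + 1)) ^ 2 * (R ^ 2 * C ^ 2 * m * 2 ^ (n * d)) := by gcongr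
        _ = _ := by ring
  calc P.real {ω | ¬ IsGoodScale α (fun e => w e ω) K m n}
      ≤ (2 ^ ((m + 1) * d)) ^ 2 * (2 * Real.exp (-t)) +
          2 ^ ((m + 1) * d) * d * (2 * Real.exp (-t)) := by
        refine (measureReal_mono fun ω hω => ?_).trans <| (measureReal_union_le _ _).trans <|
          add_le_add hpaths hdrift
        by_contra hcon
        simp only [Set.mem_union, Set.mem_ofPred_eq, not_or, not_exists, not_and, not_lt] at hcon
        exact hω ⟨fun x hx y hy hxy _ => hcon.1 (x, y) (Finset.mk_mem_product hx hy) hxy,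
          fun x hx i => hcon.2 (x, i) (Finset.mk_mem_product hx (Finset.mem_univ i))⟩
    _ ≤ (2 ^ ((m + 1) * d)) ^ 2 * (2 * Real.exp (-t)) +
          (2 ^ ((m + 1) * d)) ^ 2 * d * (2 * Real.exp (-t)) := by
        gcongr
        exact le_self_pow₀ (one_le_pow₀ one_le_two) two_ne_zero
    _ ≤ 2 * (d + 1) * (Real.exp (2 * d) * Real.exp (2 * d * m)) * Real.exp (-t) := by
        linarith [mul_le_mul_of_nonneg_right (two_pow_sq_le_exp m d)
          (show 0 ≤ 2 * (d + 1) * Real.exp (-t) by positivity)]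
    _ = 2 * (d + 1) * Real.exp (2 * d) * Real.exp (-m) := by
        rw [← mul_assoc, mul_assoc, ← Real.exp_add, ht]
        ring_nf

lemma measureReal_not_forall_isGoodScale_le {α : ℝ} (hα : 1 < α) (hC : 1 ≤ C)
    (hw : IsIndepMeanOne P (fun e : Edge d => w e) C) {R : ℝ}
    (hR : ∑' z : Lattice d, decay α z < R) {m n₀ : ℕ} (hm : 1 ≤ m)
    (hn₀ : 4 * C ^ 4 * (2 * d + 1) * m ≤ ((2 : ℝ) ^ d) ^ n₀) :
    P.real {ω | ¬ ∀ n ∈ Finset.Icc n₀ (m + 1),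
        IsGoodScale α (fun e => w e ω) (2 * (d + 1) * R * C) m n} ≤
      2 * (d + 1) * Real.exp (2 * d) * ((m + 2) * Real.exp (-m)) := by
  have hscale (n : ℕ) (hn : n ∈ Finset.Icc n₀ (m + 1)) :
      P.real {ω | ¬ IsGoodScale α (fun e => w e ω) (2 * (d + 1) * R * C) m n} ≤
        2 * (d + 1) * Real.exp (2 * d) * Real.exp (-m) := by
    obtain ⟨hlo, hhi⟩ := Finset.mem_Icc.mp hn
    refine measureReal_not_isGoodScale_le hα hC hw hR hm hhi ?_
    rw [mul_comm n, pow_mul]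
    exact hn₀.trans (pow_le_pow_right₀ (one_le_pow₀ one_le_two) hlo)
  have hcard : ((Finset.Icc n₀ (m + 1)).card : ℝ) ≤ m + 2 := by
    rw [Nat.card_Icc]
    exact_mod_cast Nat.sub_le (m + 1 + 1) n₀
  simp only [not_forall, exists_prop]
  calc _ ≤ ((Finset.Icc n₀ (m + 1)).card : ℝ) *
        (2 * (d + 1) * Real.exp (2 * d) * Real.exp (-m)) := measureReal_exists_mem_finset_le hscale
    _ ≤ (m + 2) * (2 * (d + 1) * Real.exp (2 * d) * Real.exp (-m)) := by gcongr
    _ = 2 * (d + 1) * Real.exp (2 * d) * ((m + 2) * Real.exp (-m)) := by ring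

end GoodScales

section AlmostSureScales

variable {Ω : Type*} [MeasurableSpace Ω] {P : Measure Ω}

lemma exists_measurable_bound_of_ae_eventually_notMem {T : ℕ → Set Ω}
    (hT : ∀ m, MeasurableSet (T m)) (h : ∀ᵐ ω ∂P, ∀ᶠ m in Filter.atTop, ω ∉ T m) (m₀ : ℕ) :
    ∃ m₁ : Ω → ℕ, Measurable m₁ ∧ (∀ ω, m₀ ≤ m₁ ω) ∧ ∀ᵐ ω ∂P, ∀ m, m₁ ω < m → ω ∉ T m := by
  classical
  let s (N : ℕ) : Set Ω := ⋂ m, ⋂ _ : N < m, (T m)ᶜ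
  have hs (N : ℕ) : MeasurableSet (s N) :=
    MeasurableSet.iInter fun m => MeasurableSet.iInter fun _ => (hT m).compl
  -- The second alternative makes the search total off the almost sure event.
  have hex (ω : Ω) : ∃ N, ω ∈ s N ∪ (⋃ N, s N)ᶜ := by
    by_cases hω : ω ∈ ⋃ N, s N
    · exact (Set.mem_iUnion.mp hω).imp fun _ => Or.inl
    · exact ⟨0, Or.inr hω⟩
  refine ⟨fun ω => max m₀ (Nat.find (hex ω)), measurable_const.max <| measurable_find hex fun N =>
    (hs N).union (MeasurableSet.iUnion hs).compl, fun ω => le_max_left _ _, ?_⟩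
  filter_upwards [h] with ω hω m hm
  obtain ⟨N, hN⟩ := Filter.eventually_atTop.mp hω
  have hmem : ω ∈ ⋃ N, s N :=
    Set.mem_iUnion.mpr ⟨N, Set.mem_iInter₂.mpr fun m hm => hN m (le_of_lt hm)⟩
  have hfind : ω ∈ s (Nat.find (hex ω)) :=
    (Nat.find_spec (hex ω)).resolve_right fun h => h hmem
  exact Set.mem_iInter₂.mp hfind m ((le_max_right _ _).trans_lt hm)

lemma exists_measurable_bound_of_summable [IsFiniteMeasure P] {p : ℕ → Ω → Prop} {b : ℕ → ℝ}
    (hb : Summable b) {m₀ : ℕ} (hp : ∀ m, m₀ < m → P.real {ω | ¬ p m ω} ≤ b m) :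
    ∃ m₁ : Ω → ℕ, Measurable m₁ ∧ (∀ ω, m₀ ≤ m₁ ω) ∧ ∀ᵐ ω ∂P, ∀ m, m₁ ω < m → p m ω := by
  let T (m : ℕ) : Set Ω := toMeasurable P {ω | ¬ p m ω}
  have hsum : Summable fun m => P.real (T m) := by
    refine hb.of_norm_bounded_eventually_nat ?_
    filter_upwards [Filter.eventually_gt_atTop m₀] with m hm
    rw [Real.norm_of_nonneg measureReal_nonneg, measureReal_def, measure_toMeasurable]
    exact hp m hm
  have hfin : ∑' m, P (T m) ≠ ⊤ := by
    rw [← tsum_congr fun m => ofReal_measureReal (μ := P) (s := T m)]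
    exact hsum.tsum_ofReal_ne_top
  obtain ⟨m₁, hmeas, hm₁, hae⟩ := exists_measurable_bound_of_ae_eventually_notMem
    (fun m => measurableSet_toMeasurable P _) (ae_eventually_notMem hfin) m₀
  refine ⟨m₁, hmeas, hm₁, ?_⟩
  filter_upwards [hae] with ω hω m hm
  by_contra hcon
  exact hω m hm (subset_toMeasurable P _ hcon)

lemma summable_linear_mul_exp_neg : Summable fun m : ℕ => ((m : ℝ) + 2) * Real.exp (-m) := by
  have hlinear := Real.summable_pow_mul_exp_neg_nat_mul 1 one_pos
  have hconst := Real.summable_pow_mul_exp_neg_nat_mul 0 one_pos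
  refine (hlinear.add (hconst.mul_left 2)).congr fun m => ?_
  simp only [pow_one, pow_zero, neg_one_mul, one_mul]
  ring

lemma exists_scale_pow_between {A B : ℝ} (hA : 1 ≤ A) (hB : 1 < B) :
    ∃ n₀ : ℕ → ℕ, ∃ m₀ : ℕ, ∀ m, m₀ < m →
      n₀ m ≤ m + 1 ∧ A * m ≤ B ^ n₀ m ∧ B ^ n₀ m ≤ B * (A * m) := by
  have hscale (m : ℕ) (hm : 1 ≤ m) : ∃ n : ℕ, A * m ≤ B ^ n ∧ B ^ n ≤ B * (A * m) := by
    have hm' : (1 : ℝ) ≤ m := by exact_mod_cast hm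
    obtain ⟨n, hlo, hhi⟩ := exists_nat_pow_near (one_le_mul_of_one_le_of_one_le hA hm') hB
    refine ⟨n + 1, hhi.le, ?_⟩
    rw [pow_succ']
    gcongr
  choose! n₀ hlo hhi using hscale
  have hlim : Filter.Tendsto (fun m : ℕ => (m : ℝ) ^ 1 / B ^ m) Filter.atTop (nhds 0) :=
    tendsto_pow_const_div_const_pow_of_one_lt 1 hB
  obtain ⟨m₀, hm₀⟩ := Filter.eventually_atTop.mp
    (hlim.eventually (gt_mem_nhds (show (0 : ℝ) < A⁻¹ by positivity)))
  refine ⟨n₀, m₀, fun m hm => ⟨?_, hlo m (by lia), hhi m (by lia)⟩⟩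
  have hAm : A * m ≤ B ^ m := by
    have hlt := hm₀ m hm.le
    rw [pow_one, div_lt_iff₀ (by positivity), inv_mul_eq_div, lt_div_iff₀' (by positivity)] at hlt
    exact hlt.le
  rw [← pow_le_pow_iff_right₀ hB, pow_succ']
  exact (hhi m (by lia)).trans (by gcongr)

lemma one_le_of_isIndepMeanOne_edge {d : ℕ} (hd : 0 < d) {w : Sym2 (Lattice d) → Ω → ℝ} {C : ℝ}
    (hw : IsIndepMeanOne P (fun e : Edge d => w e) C) : 1 ≤ C :=
  have : NeZero d := ⟨hd.ne'⟩
  hw.one_le ⟨s(0, 1), by simp⟩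

lemma exists_ae_forall_isGoodScale {d : ℕ} (hd : 0 < d) {w : Sym2 (Lattice d) → Ω → ℝ} {α C : ℝ}
    (hα : 1 < α) (hw : IsIndepMeanOne P (fun e : Edge d => w e) C) :
    ∃ K A : ℝ, 0 < K ∧ 0 < A ∧ ∃ n₀ : ℕ → ℕ, ∃ m₁ : Ω → ℕ, Measurable m₁ ∧ (∀ ω, 1 ≤ m₁ ω) ∧
      ∀ᵐ ω ∂P, ∀ m, m₁ ω < m →
        n₀ m ≤ m + 1 ∧ (m : ℝ) ≤ (2 ^ d) ^ n₀ m ∧ (2 ^ d) ^ n₀ m ≤ A * m ∧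
        ∀ n ∈ Finset.Icc (n₀ m) (m + 1), IsGoodScale α (fun e => w e ω) K m n := by
  have := hw.indep.isProbabilityMeasure
  have hC : 1 ≤ C := one_le_of_isIndepMeanOne_edge hd hw
  set R := ∑' z : Lattice d, decay α z + 1
  have hR : 0 < R := add_pos_of_nonneg_of_pos (tsum_nonneg (decay_nonneg α)) one_pos
  set A := 4 * C ^ 4 * (2 * (d : ℝ) + 1)
  have hA : 1 ≤ A := one_le_mul_of_one_le_of_one_le
    (one_le_mul_of_one_le_of_one_le (by norm_num) (one_le_pow₀ hC))
    (le_add_of_nonneg_left (by positivity))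
  obtain ⟨n₀, m₀, hn₀⟩ := exists_scale_pow_between hA
    (one_lt_pow₀ (one_lt_two : (1 : ℝ) < 2) hd.ne')
  set K := 2 * (d + 1) * R * C
  obtain ⟨m₁, hmeas, hm₁, hae⟩ := exists_measurable_bound_of_summable (m₀ := max 1 m₀)
    (summable_linear_mul_exp_neg.mul_left (2 * (d + 1) * Real.exp (2 * d)))
    fun m hm => measureReal_not_forall_isGoodScale_le hα hC hw (lt_add_one _)
      ((le_max_left _ _).trans hm.le) (hn₀ m ((le_max_right _ _).trans_lt hm)).2.1
  refine ⟨K, 2 ^ d * A, by positivity, by positivity, n₀, m₁, hmeas,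
    fun ω => (le_max_left _ _).trans (hm₁ ω), ?_⟩
  filter_upwards [hae] with ω hω m hm
  obtain ⟨htop, hlo, hhi⟩ := hn₀ m (((le_max_right _ _).trans (hm₁ ω)).trans_lt hm)
  exact ⟨htop, (le_mul_of_one_le_left (by positivity) hA).trans hlo,
    hhi.trans_eq (mul_assoc _ _ _).symm, hω m hm⟩

end AlmostSureScales

section LocalPoisson

variable {d : ℕ} {α C K : ℝ} {w : Sym2 (Lattice d) → ℝ}

lemma kernel_symm (α : ℝ) (w : Sym2 (Lattice d) → ℝ) (x y : Lattice d) :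
    kernel α w x y = kernel α w y x := by
  rw [kernel, kernel, Sym2.eq_swap, ← neg_sub y x, toEuclidean_neg, norm_neg]

lemma kernel_self (hα : 0 < α) (w : Sym2 (Lattice d) → ℝ) (x : Lattice d) :
    kernel α w x x = 0 := by
  rw [kernel, sub_self, toEuclidean_zero, norm_zero, Real.zero_rpow (by positivity), div_zero]

lemma kernel_nonneg (hα : 0 < α) (hw : BoundedBy w C) (x y : Lattice d) :
    0 ≤ kernel α w x y := by
  rcases eq_or_ne x y with rfl | h
  · rw [kernel_self hα]
  · exact div_nonneg (hw x y h).1 (by positivity)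

lemma sum_subtype_filter {M : Type*} [AddCommMonoid M] (U : Finset (Lattice d))
    (p : Lattice d → Prop) [DecidablePred p] (F : Lattice d → M) :
    ∑ y : U with p y.1, F y = ∑ y ∈ U with p y, F y := by
  rw [Finset.sum_filter, Finset.sum_filter]
  exact Finset.sum_coe_sort U fun y => if p y then F y else 0

lemma card_filter_cell_eq {m n : ℕ} (hn : n ≤ m + 1) (x : box d (2 ^ m)) :
    Finset.card {y : box d (2 ^ m) | cell m n y.1 = cell m n x.1} = 2 ^ (n * d) := by
  rw [← card_block hn x.2, block, Finset.card_eq_sum_ones, Finset.card_eq_sum_ones]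
  exact sum_subtype_filter _ (fun y => cell m n y = cell m n x.1) fun _ => 1

lemma blockAvg_cell {m n : ℕ} (hn : n ≤ m + 1) (F : Lattice d → ℝ) (x : box d (2 ^ m)) :
    blockAvg (fun y : box d (2 ^ m) => cell m n y.1) (fun y => F y) x =
      (∑ y ∈ block m n x, F y) / 2 ^ (n * d) := by
  rw [blockAvg, card_filter_cell_eq hn, block,
    sum_subtype_filter _ (fun y => cell m n y = cell m n x.1) F, Nat.cast_pow, Nat.cast_ofNat]

lemma le_mul_kernel_of_cell_eq (hα : 0 < α) (hw : BoundedBy w C) {m n : ℕ} {x y : Lattice d}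
    (hxy : x ≠ y) (hc : cell m n x = cell m n y) :
    w s(x, y) ≤ ((d : ℝ) * 2 ^ n) ^ ((d : ℝ) + α) * kernel α w x y := by
  have hpos : 0 < ‖toEuclidean (x - y)‖ := by
    rw [norm_pos_iff, ← toEuclidean_zero, toEuclidean_injective.ne_iff]
    exact sub_ne_zero.mpr hxy
  rw [kernel, mul_div_assoc', le_div_iff₀ (by positivity), mul_comm]
  have hw0 := (hw x y hxy).1
  gcongr
  exact norm_sub_le_of_cell_eq hc

lemma mul_two_pow_rpow (d n : ℕ) (α : ℝ) :
    ((d : ℝ) * 2 ^ n) ^ ((d : ℝ) + α) =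
      2 ^ (n * d) * ((d : ℝ) ^ ((d : ℝ) + α) * ((2 : ℝ) ^ α) ^ n) := by
  rw [Real.mul_rpow (by positivity) (by positivity),
    Real.rpow_add (by positivity : (0 : ℝ) < 2 ^ n), Real.rpow_natCast, ← pow_mul,
    Real.rpow_pow_comm (by norm_num)]
  ring

lemma sum_sq_sub_blockAvg_cell_le (hα : 0 < α) (hC : 0 ≤ C) (hw : BoundedBy w C) {m n : ℕ}
    (hn : n ≤ m + 1) (hgood : IsGoodScale α w K m n) (f : box d (2 ^ m) → ℝ) :
    ∑ x, (f x - blockAvg (fun y : box d (2 ^ m) => cell m n y.1) f x) ^ 2 ≤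
      32 * C * (d : ℝ) ^ ((d : ℝ) + α) * ((2 : ℝ) ^ α) ^ n *
        dirichlet (fun x y : box d (2 ^ m) => kernel α w x y) f := by
  have hpoincare := sum_sq_sub_blockAvg_le (w := fun x y : box d (2 ^ m) => w s(x.1, y.1))
    (k := fun x y : box d (2 ^ m) => kernel α w x y) (ρ := ((d : ℝ) * 2 ^ n) ^ ((d : ℝ) + α))
    (card_filter_cell_eq hn) hC (by positivity) (fun x y => kernel_nonneg hα hw x y)
    (fun x y hxy => hw x y (Subtype.coe_ne_coe.mpr hxy))
    (fun x y hxy hc => le_mul_kernel_of_cell_eq hα hw (Subtype.coe_ne_coe.mpr hxy) hc)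
    (fun x y hxy hc => by
      have hpaths := hgood.paths x x.2 y y.2 (Subtype.coe_ne_coe.mpr hxy) hc
      rw [block, Finset.filter_filter, ← sum_subtype_filter] at hpaths
      simpa only [ne_eq, Subtype.ext_iff, Nat.cast_pow, Nat.cast_ofNat] using hpaths) f
  refine hpoincare.trans_eq ?_
  rw [mul_two_pow_rpow]
  push_cast
  field_simp

lemma eq_of_dirichlet_eq_zero (hα : 0 < α) (hC : 0 ≤ C) (hw : BoundedBy w C) {m : ℕ}
    (hgood : IsGoodScale α w K m (m + 1)) {f : box d (2 ^ m) → ℝ}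
    (hf : dirichlet (fun x y : box d (2 ^ m) => kernel α w x y) f = 0) (x y : box d (2 ^ m)) :
    f x = f y := by
  set c := fun y : box d (2 ^ m) => cell m (m + 1) y.1
  have hpoincare := sum_sq_sub_blockAvg_cell_le hα hC hw le_rfl hgood f
  rw [hf, mul_zero] at hpoincare
  have hsq := (Finset.sum_eq_zero_iff_of_nonneg fun x _ => sq_nonneg _).mp
    (hpoincare.antisymm (Finset.sum_nonneg fun x _ => sq_nonneg _))
  have hconst (x : box d (2 ^ m)) : f x = blockAvg c f x :=
    sub_eq_zero.mp (pow_eq_zero_iff two_ne_zero |>.mp (hsq x (Finset.mem_univ x)))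
  have hc : c x = c y := (cell_top m x.2).trans (cell_top m y.2).symm
  rw [hconst x, hconst y, blockAvg, blockAvg, hc]

lemma localGenerator_apply (α : ℝ) (w : Sym2 (Lattice d) → ℝ) {U : Finset (Lattice d)}
    (φ : U → EuclideanSpace ℝ (Fin d)) (x : U) (i : Fin d) :
    localGenerator α w U φ x i =
      generator (fun x y : U => kernel α w x y) (fun x => φ x i) x := by
  rw [generator_apply, ← Finset.sum_erase (a := x) Finset.univ (by simp)]
  simp [localGenerator, WithLp.ofLp_sum, Finset.sum_apply]

lemma localEnergy_eq_sum_dirichlet (α : ℝ) (w : Sym2 (Lattice d) → ℝ) {U : Finset (Lattice d)}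
    (φ : U → EuclideanSpace ℝ (Fin d)) :
    localEnergy α w U φ =
      ∑ i, dirichlet (fun x y : U => kernel α w x y) fun x => φ x i := by
  simp only [localEnergy, dirichlet, ← Finset.mul_sum]
  congr! 3 with i _ x
  exact Finset.sum_erase _ (by simp)

lemma isLocalCorrector_iff {U : Finset (Lattice d)} (φ : U → EuclideanSpace ℝ (Fin d)) :
    IsLocalCorrector α w U φ ↔ ∀ i, generator (fun x y : U => kernel α w x y) (fun x => φ x i) =
      (fun x : U => -drift α w x i + mean U (drift α w) i) ∧ ∑ x : U, φ x i = 0 := by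
  simp only [IsLocalCorrector, PiLp.ext_iff, funext_iff, forall_and, localGenerator_apply,
    PiLp.add_apply, PiLp.neg_apply, PiLp.zero_apply, WithLp.ofLp_sum, Finset.sum_apply]
  rw [forall_comm]

lemma sum_neg_drift_add_mean (α : ℝ) (w : Sym2 (Lattice d) → ℝ) (U : Finset (Lattice d))
    (i : Fin d) : ∑ x : U, (-drift α w x i + mean U (drift α w) i) = 0 := by
  rcases U.eq_empty_or_nonempty with rfl | hU
  · rfl
  have hcard : (U.card : ℝ) ≠ 0 := by exact_mod_cast hU.card_pos.ne'
  rw [Finset.sum_add_distrib, Finset.sum_neg_distrib, Finset.sum_coe_sort U fun x => drift α w x i]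
  simp [mean, WithLp.ofLp_sum, Finset.sum_apply, hcard]

lemma existsUnique_isLocalCorrector {U : Finset (Lattice d)}
    (hirr : ∀ f : U → ℝ, dirichlet (fun x y : U => kernel α w x y) f = 0 → ∀ x y, f x = f y) :
    ∃! φ, IsLocalCorrector α w U φ := by
  choose f hf huniq using fun i : Fin d => existsUnique_generator_eq
    (fun x y : U => kernel_symm α w x y) hirr (sum_neg_drift_add_mean α w U i)
  refine ⟨fun x => WithLp.toLp 2 fun i => f i x, (isLocalCorrector_iff _).mpr hf, fun ψ hψ => ?_⟩
  funext x
  ext i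
  exact congrFun (huniq i (fun x => ψ x i) ((isLocalCorrector_iff ψ).mp hψ i)) x

lemma sum_Ico_sqrt_div_mul_le {b B t : ℝ} (hb : 0 < b) (hbB : b < B) {n₀ M : ℕ}
    (ht : t ≤ B ^ n₀) :
    ∑ n ∈ Finset.Ico n₀ M, √t / √(B ^ n) * √(b ^ (n + 1)) ≤
      √b / (1 - √(b / B)) * √(b ^ n₀) := by
  have hB : 0 < B := hb.trans hbB
  set q := √(b / B) with hq
  have hq0 : 0 < q := by positivity
  have hq1 : 0 < 1 - q := sub_pos.mpr <| (Real.sqrt_lt' one_pos).mpr <| by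
    rwa [one_pow, div_lt_one hB]
  have hpow (n : ℕ) : √(b ^ n) / √(B ^ n) = q ^ n := by
    rw [← Real.sqrt_div (by positivity), ← div_pow, hq, Real.sqrt_eq_rpow, Real.sqrt_eq_rpow,
      Real.rpow_pow_comm (by positivity)]
  calc ∑ n ∈ Finset.Ico n₀ M, √t / √(B ^ n) * √(b ^ (n + 1))
      = √t * √b * ∑ n ∈ Finset.Ico n₀ M, q ^ n := by
        rw [Finset.mul_sum]
        refine Finset.sum_congr rfl fun n _ => ?_
        rw [← hpow n, pow_succ, Real.sqrt_mul (by positivity)]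
        ring
    _ ≤ √(B ^ n₀) * √b * (q ^ n₀ / (1 - q)) := by
        gcongr
        exact geom_sum_Ico_le_of_lt_one hq0.le (sub_pos.mp hq1)
    _ = √b / (1 - q) * √(b ^ n₀) := by
        rw [← hpow n₀]
        have : √(B ^ n₀) ≠ 0 := by positivity
        field_simp

lemma add_sum_Ico_sqrt_le {b B t C₀ K L : ℝ} (hb : 0 < b) (hbB : b < B) (hK : 0 ≤ K) (hL : 0 ≤ L)
    {n₀ M : ℕ} (ht : t ≤ B ^ n₀) :
    C₀ * √(L * b ^ n₀) +
        ∑ n ∈ Finset.Ico n₀ M, K * (√t / √(B ^ n)) * √(L * b ^ (n + 1)) ≤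
      √L * (C₀ + K * (√b / (1 - √(b / B)))) * √(b ^ n₀) := by
  calc _ = √L * C₀ * √(b ^ n₀) +
        √L * (K * ∑ n ∈ Finset.Ico n₀ M, √t / √(B ^ n) * √(b ^ (n + 1))) := by
        simp only [Real.sqrt_mul hL, Finset.mul_sum]
        congr 1
        · ring
        · exact Finset.sum_congr rfl fun n _ => by ring
    _ ≤ √L * C₀ * √(b ^ n₀) + √L * (K * (√b / (1 - √(b / B)) * √(b ^ n₀))) := by
        gcongr
        exact sum_Ico_sqrt_div_mul_le hb hbB ht
    _ = _ := by ring

lemma abs_blockAvg_drift_le {m n : ℕ} (hn : n ≤ m + 1) (hgood : IsGoodScale α w K m n)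
    (x : box d (2 ^ m)) (i : Fin d) :
    |blockAvg (fun y : box d (2 ^ m) => cell m n y.1) (fun y => drift α w y i) x| ≤
      K * (√m / √((2 ^ d) ^ n)) := by
  have hpos : (0 : ℝ) < 2 ^ (n * d) := by positivity
  rw [blockAvg_cell hn fun y => drift α w y i, abs_div, abs_of_pos hpos, ← pow_mul, mul_comm d,
    ← mul_div_assoc, div_le_iff₀ hpos, div_mul_eq_mul_div, mul_div_assoc, Real.div_sqrt]
  exact hgood.drift x x.2 i

lemma dirichlet_eq_sum_drift_mul {U : Finset (Lattice d)} {f : U → ℝ} {i : Fin d} {a : ℝ}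
    (hf : generator (fun x y : U => kernel α w x y) f = fun x : U => -drift α w x i + a)
    (hf0 : ∑ x, f x = 0) :
    dirichlet (fun x y : U => kernel α w x y) f = ∑ x : U, drift α w x i * f x := by
  rw [dirichlet_eq_neg_sum (fun x y : U => kernel_symm α w x y), hf]
  simp only [add_mul, neg_mul, Finset.sum_add_distrib, Finset.sum_neg_distrib, ← Finset.mul_sum,
    hf0, mul_zero, add_zero, neg_neg]

lemma dirichlet_le_of_forall_isGoodScale (hα : 1 < α) (hC : 0 ≤ C) (hw : BoundedBy w C) {m n₀ : ℕ}
    (hn₀ : n₀ ≤ m + 1) (hgood : ∀ n ∈ Finset.Icc n₀ (m + 1), IsGoodScale α w K m n)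
    {f : box d (2 ^ m) → ℝ} {i : Fin d} {a : ℝ}
    (hf : generator (fun x y : box d (2 ^ m) => kernel α w x y) f =
      fun x : box d (2 ^ m) => -drift α w x i + a)
    (hf0 : ∑ x, f x = 0) :
    dirichlet (fun x y : box d (2 ^ m) => kernel α w x y) f ≤ 2 ^ ((m + 1) * d) *
      ((C + 1) * (∑' z : Lattice d, decay α z) *
          √(32 * C * (d : ℝ) ^ ((d : ℝ) + α) * ((2 : ℝ) ^ α) ^ n₀) +
        ∑ n ∈ Finset.Ico n₀ (m + 1), K * (√m / √((2 ^ d) ^ n)) *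
          √(32 * C * (d : ℝ) ^ ((d : ℝ) + α) * ((2 : ℝ) ^ α) ^ (n + 1))) ^ 2 := by
  have hα0 : 0 < α := one_pos.trans hα
  have hmulti := energy_le_of_multiscale (c := fun n (x : box d (2 ^ m)) => cell m n x.1) hn₀
    (fun n x y => cell_succ m n) (fun x y => (cell_top m x.2).trans (cell_top m y.2).symm) hf0
    (dirichlet_nonneg (fun x y : box d (2 ^ m) => kernel_nonneg hα0 hw x y) f)
    (dirichlet_eq_sum_drift_mul hf hf0).le
    (fun n hlo hhi => sum_sq_sub_blockAvg_cell_le hα0 hC hw hhi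
      (hgood n (Finset.mem_Icc.mpr ⟨hlo, hhi⟩)) f)
    (fun x => abs_drift_apply_le hα hw x i)
    (fun n hlo hhi x => abs_blockAvg_drift_le hhi.le
      (hgood n (Finset.mem_Icc.mpr ⟨hlo, hhi.le⟩)) x i)
  simpa only [Fintype.card_coe, card_box, Nat.cast_pow, Nat.cast_ofNat] using hmulti

theorem exists_forall_localEnergy_le (hα : 1 < α) (hαd : α < d) (hC : 0 < C) (hK : 0 < K) :
    ∃ C₄ : ℝ, 0 < C₄ ∧ ∀ (w : Sym2 (Lattice d) → ℝ) (m n₀ : ℕ), BoundedBy w C → n₀ ≤ m + 1 →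
      (m : ℝ) ≤ (2 ^ d) ^ n₀ → (∀ n ∈ Finset.Icc n₀ (m + 1), IsGoodScale α w K m n) →
      ∀ φ, IsLocalCorrector α w (box d (2 ^ m)) φ →
        localEnergy α w (box d (2 ^ m)) φ ≤ C₄ * ((2 : ℝ) ^ α) ^ n₀ * 2 ^ (m * d) := by
  have hd : (0 : ℝ) < d := by linarith
  set b : ℝ := 2 ^ α
  have hbB : b < 2 ^ d := by
    rw [← Real.rpow_natCast]
    exact Real.rpow_lt_rpow_of_exponent_lt one_lt_two hαd
  have hq : 0 < 1 - √(b / 2 ^ d) := sub_pos.mpr <| (Real.sqrt_lt' one_pos).mpr <| by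
    rwa [one_pow, div_lt_one (by positivity)]
  set L := 32 * C * (d : ℝ) ^ ((d : ℝ) + α)
  set C₀ := (C + 1) * ∑' z : Lattice d, decay α z
  have hC₀ : 0 ≤ C₀ := mul_nonneg (by linarith) (tsum_nonneg (decay_nonneg α))
  set S := √L * (C₀ + K * (√b / (1 - √(b / 2 ^ d))))
  refine ⟨d * (2 ^ d * S ^ 2), by positivity, fun w m n₀ hw hn₀ hm hgood φ hφ => ?_⟩
  have hcoord (i : Fin d) : dirichlet (fun x y : box d (2 ^ m) => kernel α w x y)
      (fun x => φ x i) ≤ 2 ^ ((m + 1) * d) * (S * √(b ^ n₀)) ^ 2 := by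
    obtain ⟨hf, hf0⟩ := (isLocalCorrector_iff φ).mp hφ i
    refine (dirichlet_le_of_forall_isGoodScale hα hC.le hw hn₀ hgood hf hf0).trans ?_
    gcongr
    exact add_sum_Ico_sqrt_le (by positivity) hbB hK.le (by positivity) hm
  calc localEnergy α w (box d (2 ^ m)) φ
      ≤ d * (2 ^ ((m + 1) * d) * (S * √(b ^ n₀)) ^ 2) := by
        rw [localEnergy_eq_sum_dirichlet]
        simpa using Finset.sum_le_sum fun i (_ : i ∈ Finset.univ) => hcoord i
    _ = d * (2 ^ d * S ^ 2) * b ^ n₀ * 2 ^ (m * d) := by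
        rw [mul_pow, Real.sq_sqrt (by positivity)]
        ring

lemma rpow_pow_le_of_pow_le {n : ℕ} {t : ℝ} (hd : 0 < d) (hα : 0 ≤ α)
    (h : ((2 : ℝ) ^ d) ^ n ≤ t) : ((2 : ℝ) ^ α) ^ n ≤ t ^ (α / d) := by
  have hd' : (d : ℝ) ≠ 0 := by positivity
  calc ((2 : ℝ) ^ α) ^ n = (((2 : ℝ) ^ d) ^ n) ^ (α / d) := by
        rw [← Real.rpow_pow_comm (by positivity), ← Real.rpow_natCast_mul zero_le_two,
          mul_div_cancel₀ _ hd']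
    _ ≤ _ := by gcongr

end LocalPoisson

lemma exists_isIndepMeanOne {d : ℕ} {Ω : Type*} [MeasurableSpace Ω] {P : Measure Ω}
    {w : Sym2 (Lattice d) → Ω → ℝ} (hw : IIDConductances P w) :
    ∃ C : ℝ, IsIndepMeanOne P (fun e : Edge d => w e) C := by
  obtain ⟨C, -, hC⟩ := hw.bounded
  exact ⟨C, hw.measurable, hw.indep, fun e => (hw.nonneg e).and (hC e), hw.mean_one⟩

lemma div_le_one_add_mul_div_min {d α γ : ℝ} (hα : 0 < α) (hd : α < d) (hγ : 0 < γ) :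
    α / d ≤ (1 + γ) * α / min (2 * (d - α)) d := by
  have hmin : 0 < min (2 * (d - α)) d := lt_min (by linarith) (by linarith)
  gcongr
  · exact le_mul_of_one_le_left hα.le (by linarith)
  · exact min_le_right _ _

end StableConductance

open StableConductance in
theorem proposition3p1_general {Ω : Type*} [MeasurableSpace Ω] (P : Measure Ω) (d : ℕ) (α : ℝ)
    (hα : 1 < α) (hd : α < d) (w : Sym2 (Lattice d) → Ω → ℝ) (C : ℝ)
    (hw : IsIndepMeanOne P (fun e : Edge d => w e) C) (p : ℝ) (hp : α / d ≤ p) :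
    ∃ C₃ : ℝ, 0 < C₃ ∧ ∃ m₁ : Ω → ℕ, Measurable m₁ ∧ (∀ ω, 1 ≤ m₁ ω) ∧
      ∀ᵐ ω ∂P, ∀ m : ℕ, m₁ ω < m →
        ∃ φ : box d (2 ^ m) → EuclideanSpace ℝ (Fin d),
          IsLocalCorrector α (fun e => w e ω) (box d (2 ^ m)) φ ∧
          (∀ ψ : box d (2 ^ m) → EuclideanSpace ℝ (Fin d),
            IsLocalCorrector α (fun e => w e ω) (box d (2 ^ m)) ψ → ψ = φ) ∧
          localEnergy α (fun e => w e ω) (box d (2 ^ m)) φ ≤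
            C₃ * (m : ℝ) ^ p * (2 : ℝ) ^ (m * d) := by
  have hd0 : 0 < d := by exact_mod_cast (by linarith : (0 : ℝ) < d)
  have hC : 0 < C := one_pos.trans_le (one_le_of_isIndepMeanOne_edge hd0 hw)
  obtain ⟨K, A, hK, hA, n₀, m₁, hmeas, hm₁, hgood⟩ := exists_ae_forall_isGoodScale hd0 hα hw
  obtain ⟨C₄, hC₄, henergy⟩ := exists_forall_localEnergy_le hα hd hC hK
  refine ⟨C₄ * A ^ (α / d), by positivity, m₁, hmeas, hm₁, ?_⟩
  filter_upwards [ae_boundedBy hw, hgood] with ω hω hgood m hm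
  obtain ⟨hn₀, hlo, hhi, hscales⟩ := hgood m hm
  obtain ⟨φ, hφ, huniq⟩ := existsUnique_isLocalCorrector fun f hf =>
    eq_of_dirichlet_eq_zero (by linarith) hC.le hω
      (hscales (m + 1) (Finset.right_mem_Icc.mpr hn₀)) hf
  refine ⟨φ, hφ, huniq, (henergy _ m (n₀ m) hω hn₀ hlo hscales φ hφ).trans ?_⟩
  have hm1 : (1 : ℝ) ≤ m := by exact_mod_cast (hm₁ ω).trans hm.le
  calc C₄ * ((2 : ℝ) ^ α) ^ n₀ m * 2 ^ (m * d)
      ≤ C₄ * (A * m) ^ (α / d) * 2 ^ (m * d) := by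
        gcongr
        exact rpow_pow_le_of_pow_le hd0 (by linarith) hhi
    _ = C₄ * A ^ (α / d) * (m : ℝ) ^ (α / d) * 2 ^ (m * d) := by
        rw [Real.mul_rpow hA.le m.cast_nonneg, ← mul_assoc C₄]
    _ ≤ C₄ * A ^ (α / d) * (m : ℝ) ^ p * 2 ^ (m * d) := by
        gcongr

theorem proposition3p1 {Ω : Type*} [MeasurableSpace Ω] (P : Measure Ω) [IsProbabilityMeasure P]
    (d : ℕ) (α : ℝ) (hα₁ : 1 < α) (hα₂ : α < 2) (hd : α < (d : ℝ))
    (w : Sym2 (StableConductance.Lattice d) → Ω → ℝ)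
    (hw : StableConductance.IIDConductances P w)
    (γ : ℝ) (hγ : 0 < γ) :
    ∃ C₃ : ℝ, 0 < C₃ ∧ ∃ m₁ : Ω → ℕ, Measurable m₁ ∧ (∀ ω, 1 ≤ m₁ ω) ∧
      ∀ᵐ ω ∂P, ∀ m : ℕ, m₁ ω < m →
        ∃ φ : StableConductance.box d (2 ^ m) → EuclideanSpace ℝ (Fin d),
          StableConductance.IsLocalCorrector α (fun e => w e ω)
            (StableConductance.box d (2 ^ m)) φ ∧
          (∀ ψ : StableConductance.box d (2 ^ m) → EuclideanSpace ℝ (Fin d),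
            StableConductance.IsLocalCorrector α (fun e => w e ω)
              (StableConductance.box d (2 ^ m)) ψ → ψ = φ) ∧
          StableConductance.localEnergy α (fun e => w e ω)
              (StableConductance.box d (2 ^ m)) φ ≤
            C₃ * (m : ℝ) ^ ((1 + γ) * α / min (2 * ((d : ℝ) - α)) (d : ℝ)) *
              (2 : ℝ) ^ (m * d) := by
  obtain ⟨C, hC⟩ := StableConductance.exists_isIndepMeanOne hw
  exact proposition3p1_general P d α hα₁ hd w C hC _
    (StableConductance.div_le_one_add_mul_div_min (one_pos.trans hα₁) hd hγ)
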